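/- Let $p>1$, let $x_1,x_2,\dots$ be non-random covariate vectors lying in a compact subset of $\mathbb R^p$, and for $s\subseteq S=\{1,\dots,p\}$ let $x_{t,s}$ be the subvector of $x_t$ indexed by $s$. The model $s$ is $$y_t=\rho\,y_{t-1}+\beta_s' x_{t,s}+\varepsilon_t,\qquad y_0=0,\quad \varepsilon_t\stackrel{iid}{\sim}N(0,\sigma^2),\qquad t=1,\dots,n,$$ with independent $g$-prior $\beta_s\sim N\big(\beta_{0,s},\,g_n\sigma^2(Z_s'Z_s)^{-1}\big)$ given $\rho$ and $\sigma^2$, where $\beta_{0,s}$ is fixed, $g_n>0$, $g_n=O(1)$, and $Z_s=Z_{n,s}(\rho)$ has rows $z_{t,s}=\sum_{k=1}^t\rho^{t-k}x_{k,s}$. It is assumed that for every $s$ and every $\rho\in[-1+\gamma,1-\gamma]$ the matrix $Z_s'Z_s$ is nonsingular for all large $n$ (so that the priors are defined; in particular no covariate vanishes identically). Put $\mu_{n,s}(\rho)=Z_s\beta_{0,s}$, $L(\rho)=(\rho^{t-k}1_{k\le t})_{1\le t,k\le n}$ and $$H_{n,s}(\rho)=L(\rho)L(\rho)'+g_nZ_s(Z_s'Z_s)^{-1}Z_s',$$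 so that ${\bf y}_n=(y_1,\dots,y_n)'\sim N_n(\mu_{n,s}(\rho),\sigma^2H_{n,s}(\rho))$ given $\rho,\sigma^2$. The variance $\sigma^2$ has the inverse-gamma prior density $\frac{\beta^\alpha}{\Gamma(\alpha)}v^{-(\alpha+1)}e^{-\beta/v}$, $v>0$, with $\alpha>2$, $\beta>0$, and $m_{n,s}({\bf y}_n;\rho)$ denotes the density of ${\bf y}_n$ given $\rho$ after $\sigma^2$ is integrated out. The coefficient $\rho$ has a prior with Lebesgue density $\pi$ on $[-1+\gamma,1-\gamma]$, where $\gamma>0$. The data come from the true set $s_0\subseteq S$, the true coefficient $\rho_0$ with $|\rho_0|<1-\gamma$, and a fixed true error variance $\sigma_0^2>0$: for all large $n$, ${\bf y}_n\sim N_n(\mu_{n,s_0}(\rho_0),\sigma_0^2H_{n,s_0}(\rho_0))$, all ${\bf y}_n$ being defined on one probability space, with arbitrary joint law for different $n$. Put $$BF^n_{s,s_0}(\rho)=\frac{m_{n,s}({\bf y}_n;\rho)}{m_{n,s_0}({\bf y}_n;\rho_0)},\qquad IBF^n_{s,s_0}=\int_{-1+\gamma}^{1-\gamma}BF^n_{s,s_0}(\rho)\,\pi(\rho)\,d\rho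 .$$ Assume that for every $s\ne s_0$: (a) $\liminf_n n^{-1}\|\mu_{n,s}(\rho)-\mu_{n,s_0}(\rho_0)\|^2>0$ for every $\rho\in[-1+\gamma,1-\gamma]$; (b) $\rho\mapsto\limsup_n E\big[\tfrac1n\log BF^n_{s,s_0}(\rho)\big]$ is upper semicontinuous and $\rho\mapsto\liminf_n E\big[\tfrac1n\log BF^n_{s,s_0}(\rho)\big]$ is lower semicontinuous on $[-1+\gamma,1-\gamma]$. Then there is a constant $\delta>0$ such that, almost surely, $$\max_{s\ne s_0}\ \limsup_{n\to\infty}\frac1n\log IBF^n_{s,s_0}=-\delta .$$ -/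

import Mathlib

open MeasureTheory ProbabilityTheory Filter Set
open scoped Matrix

namespace AR1Selection

noncomputable section

/-- The density of the `n`-variate normal law `N_n(μ, V)` (for positive definite `V`). -/
def gaussianDensity {n : ℕ} (μ : Fin n → ℝ) (V : Matrix (Fin n) (Fin n) ℝ)
    (y : Fin n → ℝ) : ℝ :=
  (√((2 * Real.pi) ^ n * V.det))⁻¹ * Real.exp (-((y - μ) ⬝ᵥ (V⁻¹ *ᵥ (y - μ))) / 2)

/-- The inverse-gamma density with parameters `α`, `β`, as a function of the variance `v > 0`. -/
def invGammaDensity (α β v : ℝ) : ℝ :=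
  β ^ α / Real.Gamma α * v ^ (-(α + 1)) * Real.exp (-β / v)

/-- The lower triangular matrix `L(ρ)` with entries `ρ ^ (t - k)`, `k ≤ t`. The solution of
`y_t = ρ y_{t-1} + u_t`, started from the value zero, is `y = L(ρ) u`.
(Time is indexed from zero, so that index `t` stands for the time point `t + 1`.) -/
def ar1Filter (n : ℕ) (ρ : ℝ) : Matrix (Fin n) (Fin n) ℝ :=
  Matrix.of fun t k => if k ≤ t then ρ ^ ((t : ℕ) - (k : ℕ)) else 0

variable {p : ℕ}

/-- The matrix `Z_s` with rows `z_{t,s} = ∑_{k ≤ t} ρ ^ (t - k) x_{k,s}`; here `x t j` is the value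
of the `j`-th covariate at time index `t`. -/
def designZ (x : ℕ → Fin p → ℝ) (s : Finset (Fin p)) (n : ℕ) (ρ : ℝ) :
    Matrix (Fin n) s ℝ :=
  Matrix.of fun t j => ∑ k ∈ Finset.range ((t : ℕ) + 1), ρ ^ ((t : ℕ) - k) * x k j

/-- The mean `μ_s` of `(y_1, …, y_n)` given `ρ`, when `β_s` has the prior mean `b s`. -/
def meanVec (x : ℕ → Fin p → ℝ) (b : (s : Finset (Fin p)) → s → ℝ)
    (s : Finset (Fin p)) (n : ℕ) (ρ : ℝ) : Fin n → ℝ :=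
  designZ x s n ρ *ᵥ b s

/-- The covariance matrix of `(y_1, …, y_n)` given `ρ` and `σ²`, divided by `σ²`: for
`y_t = ρ y_{t-1} + β_s' x_{t,s} + ε_t`, `y_0 = 0`, with `ε_t` i.i.d. `N(0, σ²)` and
`β_s ~ N(b s, g_n σ² (Z_s' Z_s)⁻¹)` independent of the errors, `y = Z_s β_s + L(ρ) ε`. -/
def scaleMat (x : ℕ → Fin p → ℝ) (g : ℕ → ℝ) (s : Finset (Fin p)) (n : ℕ) (ρ : ℝ) :
    Matrix (Fin n) (Fin n) ℝ :=
  ar1Filter n ρ * (ar1Filter n ρ)ᵀ +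
    g n • (designZ x s n ρ * ((designZ x s n ρ)ᵀ * designZ x s n ρ)⁻¹ * (designZ x s n ρ)ᵀ)

/-- The law of `(y_1, …, y_n)` under the model `s` for given `ρ` and given error variance `v`. -/
def modelLaw (x : ℕ → Fin p → ℝ) (b : (s : Finset (Fin p)) → s → ℝ) (g : ℕ → ℝ)
    (s : Finset (Fin p)) (n : ℕ) (ρ v : ℝ) : Measure (EuclideanSpace ℝ (Fin n)) :=
  multivariateGaussian (WithLp.toLp 2 (meanVec x b s n ρ)) (v • scaleMat x g s n ρ)

/-- The marginal likelihood of the model `s` given `ρ`: the error variance is integrated out with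
respect to its inverse-gamma prior. -/
def marginal (x : ℕ → Fin p → ℝ) (b : (s : Finset (Fin p)) → s → ℝ) (g : ℕ → ℝ) (α β : ℝ)
    (s : Finset (Fin p)) (n : ℕ) (ρ : ℝ) (y : EuclideanSpace ℝ (Fin n)) : ℝ :=
  ∫ v in Ioi (0 : ℝ),
    gaussianDensity (meanVec x b s n ρ) (v • scaleMat x g s n ρ) y.ofLp * invGammaDensity α β v

/-- The Bayes factor `BF^n_{s,s₀}(ρ)` of the model `s` with autoregression coefficient `ρ` against
the true model `s₀` with the true coefficient `ρ₀`. -/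
def bayesFactor (x : ℕ → Fin p → ℝ) (b : (s : Finset (Fin p)) → s → ℝ) (g : ℕ → ℝ) (α β : ℝ)
    (s s₀ : Finset (Fin p)) (ρ₀ : ℝ) (n : ℕ) (ρ : ℝ) (y : EuclideanSpace ℝ (Fin n)) : ℝ :=
  marginal x b g α β s n ρ y / marginal x b g α β s₀ n ρ₀ y

/-- The integrated Bayes factor `IBF^n_{s,s₀}`, for the prior density `π` of `ρ` on
`[-1 + γ, 1 - γ]`. -/
def integratedBayesFactor (x : ℕ → Fin p → ℝ) (b : (s : Finset (Fin p)) → s → ℝ) (g : ℕ → ℝ)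
    (α β : ℝ) (s s₀ : Finset (Fin p)) (ρ₀ γ : ℝ) (π : ℝ → ℝ) (n : ℕ)
    (y : EuclideanSpace ℝ (Fin n)) : ℝ :=
  ∫ ρ in Icc (-1 + γ) (1 - γ), bayesFactor x b g α β s s₀ ρ₀ n ρ y * π ρ

end

end AR1Selection

namespace AR1Selection

noncomputable section

/-! ### Concentration of Gaussian quadratic forms -/

/-! Let `A = 1 - ρN`, with `N` the lower shift, be the inverse of the filter `L(ρ)`. Whitening by
`A` turns `H` into `1 + g S`, where `S = A P A'` and `P` is the projection on the columns of
`Z_s(ρ)`. Since `|ρ| ≤ 1 - γ`, both `A` and `A'` satisfy `γ‖u‖ ≤ ‖Au‖ ≤ 2‖u‖`, so `S` has bounded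
norm and trace at most `4p`, and `log det H` is bounded. Integrating out the variance gives a
multivariate t density, hence `(1/n) log BF` is, up to `O(1/n)`, a bounded factor times `log (β +
Q₀/2) - log (β + Q/2)`, where `Q₀`, `Q` are the residual forms of the true and the candidate model
(`log_bayesFactor`).

The residual form is close to a deterministic `limitForm`, uniformly in `ρ`. Two facts give the
uniformity: `A` is affine in `ρ`, and `A Z_s(ρ) = X_s` does not depend on `ρ`, so that `1 - (1 + g
S)⁻¹` lives on the fixed column space of `X_s`, of dimension at most `p`. The error is therefore
bounded by finitely many statistics free of `ρ` (`abs_residualForm_sub_limitForm_le`). By Chernoff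
bounds for Gaussian quadratic forms and Borel–Cantelli these are almost surely `o(n)`
(`ae_tendsto_quadratic`, `ae_tendsto_fluctuation`); only the law of each single `Y n` matters.

Consequently `(1/n) log BF` at two typical outcomes differs by `o(1)` uniformly in `ρ`, and so does
`(1/n) log IBF`. Its upper limit is thus almost surely a constant, which can be read off at one
fixed typical outcome, although no limit need exist (`limsup_integratedBayesFactor`).

The constant is negative and finite. For the true model `Q₀/n → σ₀²`. For a candidate the noise
contributes at least `σ₀² n`, because `A(ρ) L(ρ₀)` is unit lower triangular, and the mean difference
adds at least `c n`, uniformly in `ρ` by compactness (`exists_uniform_separation`). So the Bayes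
factor lies between `exp (-M n)` and `exp (-ζ n)` for all `ρ` at once
(`exists_log_bayesFactor_bounds`), and averaging against `π` keeps these bounds. A maximum over
finitely many candidates finishes the proof. -/

lemma gaussianReal_exp_mul_sq {t : ℝ} (ht : t < 1 / 2) :
    Integrable (fun x => Real.exp (t * x ^ 2)) (gaussianReal 0 1) ∧
      ∫ x, Real.exp (t * x ^ 2) ∂(gaussianReal 0 1) = (√(1 - 2 * t))⁻¹ := by
  have hb : 0 < 1 / 2 - t := by linarith
  have key : ∀ x : ℝ, gaussianPDFReal 0 1 x * Real.exp (t * x ^ 2) =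
      (√(2 * Real.pi))⁻¹ * Real.exp (-(1 / 2 - t) * x ^ 2) := by
    intro x
    simp only [gaussianPDFReal, NNReal.coe_one, mul_one, sub_zero]
    rw [mul_assoc, ← Real.exp_add]
    congr 2
    ring
  constructor
  · rw [gaussianReal_of_var_ne_zero _ one_ne_zero,
      integrable_withDensity_iff_integrable_smul' (measurable_gaussianPDF 0 1)
        (ae_of_all _ fun x => gaussianPDF_lt_top)]
    simp only [toReal_gaussianPDF, smul_eq_mul, key]
    exact (integrable_exp_neg_mul_sq hb).const_mul _
  · rw [integral_gaussianReal_eq_integral_smul one_ne_zero]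
    simp only [smul_eq_mul, key]
    rw [integral_const_mul, integral_gaussian, ← Real.sqrt_inv, ← Real.sqrt_inv,
      ← Real.sqrt_mul (by positivity)]
    congr 1
    have : (1 - 2 * t) ≠ 0 := by linarith
    field_simp

lemma gaussianReal_integral_exp_mul_sq_le {t : ℝ} (ht : |t| ≤ 1 / 4) :
    ∫ x, Real.exp (t * x ^ 2) ∂(gaussianReal 0 1) ≤ Real.exp (t + 4 * t ^ 2) := by
  have h1 := abs_le.1 ht
  rw [(gaussianReal_exp_mul_sq (by linarith [h1.2])).2]
  have hpos : 0 < 1 - 2 * t := by linarith [h1.2]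
  have h2 : |2 * t| < 1 := by rw [abs_lt]; constructor <;> linarith
  -- First-order Taylor bound of `log (1 - 2t)`: the remainder is at most `(2t)² / (1 - 2|t|) ≤
  -- 8t²`, and the square root halves it.
  have h3 := Real.abs_log_sub_add_sum_range_le h2 1
  simp only [Finset.sum_range_one] at h3
  norm_num at h3
  have h4 : (2 * |t|) ^ 2 / (1 - 2 * |t|) ≤ 8 * t ^ 2 := by
    rw [div_le_iff₀ (by linarith), mul_pow, sq_abs]
    nlinarith [sq_nonneg t]
  have h5 := (abs_le.1 (h3.trans h4)).1
  rw [← Real.log_le_log_iff (by positivity) (by positivity), Real.log_exp, Real.log_inv,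
    Real.log_sqrt hpos.le]
  linarith

section Concentration

variable {n : ℕ}

lemma eigenvalues_abs_le {ι : Type*} [Fintype ι] [DecidableEq ι] {B : Matrix ι ι ℝ}
    (hB : B.IsHermitian) {K : ℝ}
    (hK : ∀ u : ι → ℝ, |u ⬝ᵥ B *ᵥ u| ≤ K * (u ⬝ᵥ u)) (i : ι) : |hB.eigenvalues i| ≤ K := by
  have h := hK ((hB.eigenvectorBasis i).ofLp)
  rw [hB.mulVec_eigenvectorBasis i, dotProduct_smul] at h
  have h1 : (hB.eigenvectorBasis i).ofLp ⬝ᵥ (hB.eigenvectorBasis i).ofLp = 1 := by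
    have := hB.eigenvectorBasis.orthonormal.1 i
    have h2 := EuclideanSpace.real_norm_sq_eq (hB.eigenvectorBasis i)
    rw [this] at h2
    simp only [dotProduct, ← sq]
    linarith
  simpa [h1] using h

lemma quadratic_eigenvectorBasis {ι : Type*} [Fintype ι] [DecidableEq ι] {B : Matrix ι ι ℝ}
    (hB : B.IsHermitian) (x : ι → ℝ) :
    (∑ i, x i • hB.eigenvectorBasis i).ofLp ⬝ᵥ
      B *ᵥ (∑ i, x i • hB.eigenvectorBasis i).ofLp = ∑ i, hB.eigenvalues i * x i ^ 2 := by
  have h1 : B *ᵥ (∑ i, x i • hB.eigenvectorBasis i).ofLp =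
      (∑ i, (x i * hB.eigenvalues i) • hB.eigenvectorBasis i).ofLp := by
    simp only [WithLp.ofLp_sum, WithLp.ofLp_smul, Matrix.mulVec_sum, Matrix.mulVec_smul,
      hB.mulVec_eigenvectorBasis, mul_smul]
  have h2 : ∀ a c : EuclideanSpace ℝ ι, a.ofLp ⬝ᵥ c.ofLp = inner ℝ a c := by
    intro a c
    simp [PiLp.inner_apply, dotProduct, mul_comm]
  rw [h1, h2, sum_inner]
  refine Finset.sum_congr rfl fun i _ => ?_
  rw [inner_smul_left, inner_sum]
  simp only [inner_smul_right, orthonormal_iff_ite.1 hB.eigenvectorBasis.orthonormal]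
  simp
  ring

/-- In an orthonormal eigenbasis of `B` the coordinates of a standard Gaussian vector are again
independent standard normal, so the moment generating function is a product of the one-dimensional
ones with parameters `t λ_i`, `|λ_i| ≤ K`. -/
lemma mgf_quadratic_stdGaussian {B : Matrix (Fin n) (Fin n) ℝ} (hB : B.IsHermitian) {K t : ℝ}
    (hK : ∀ u : Fin n → ℝ, |u ⬝ᵥ B *ᵥ u| ≤ K * (u ⬝ᵥ u)) (ht : |t| * K ≤ 1 / 4) :
    Integrable (fun z => Real.exp (t * (z.ofLp ⬝ᵥ B *ᵥ z.ofLp)))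
        (stdGaussian (EuclideanSpace ℝ (Fin n))) ∧
      mgf (fun z => z.ofLp ⬝ᵥ B *ᵥ z.ofLp) (stdGaussian (EuclideanSpace ℝ (Fin n))) t ≤
        Real.exp (t * B.trace + 4 * t ^ 2 * K ^ 2 * n) := by
  have hev := eigenvalues_abs_le hB hK
  have hle : ∀ i, |t * hB.eigenvalues i| ≤ 1 / 4 := fun i => by
    rw [abs_mul]
    exact (mul_le_mul_of_nonneg_left (hev i) (abs_nonneg t)).trans ht
  have hmeas : Measurable (fun x : Fin n → ℝ => ∑ i, x i • hB.eigenvectorBasis i) := by fun_prop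
  have hcont : Continuous fun z : EuclideanSpace ℝ (Fin n) =>
      Real.exp (t * (z.ofLp ⬝ᵥ B *ᵥ z.ofLp)) := by
    simp only [dotProduct, Matrix.mulVec]
    fun_prop
  have hprod : ∀ x : Fin n → ℝ, Real.exp (t * ((∑ i, x i • hB.eigenvectorBasis i).ofLp ⬝ᵥ
      B *ᵥ (∑ i, x i • hB.eigenvectorBasis i).ofLp)) =
      ∏ i, Real.exp ((t * hB.eigenvalues i) * x i ^ 2) := by
    intro x
    rw [quadratic_eigenvectorBasis, Finset.mul_sum, Real.exp_sum]
    simp only [mul_assoc]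
  have hlt : ∀ i, t * hB.eigenvalues i < 1 / 2 := fun i => by
    linarith [(abs_le.1 (hle i)).2]
  rw [stdGaussian_eq_map_pi_orthonormalBasis hB.eigenvectorBasis]
  constructor
  · rw [integrable_map_measure hcont.aestronglyMeasurable hmeas.aemeasurable]
    simp only [Function.comp_def, hprod]
    exact Integrable.fintype_prod (f := fun i x => Real.exp ((t * hB.eigenvalues i) * x ^ 2))
      fun i => (gaussianReal_exp_mul_sq (hlt i)).1
  · rw [mgf, integral_map hmeas.aemeasurable hcont.aestronglyMeasurable]
    simp only [hprod]
    rw [integral_fintype_prod_eq_prod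
      (f := fun i x => Real.exp ((t * hB.eigenvalues i) * x ^ 2))]
    calc _ ≤ ∏ i, Real.exp (t * hB.eigenvalues i + 4 * t ^ 2 * K ^ 2) := by
          refine Finset.prod_le_prod (fun i _ => integral_nonneg fun x => (Real.exp_pos _).le)
            fun i _ => (gaussianReal_integral_exp_mul_sq_le (hle i)).trans ?_
          rw [Real.exp_le_exp, mul_pow]
          have : hB.eigenvalues i ^ 2 ≤ K ^ 2 := sq_le_sq' (abs_le.1 (hev i)).1 (abs_le.1 (hev i)).2
          nlinarith [sq_nonneg t]
      _ = _ := by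
          rw [← Real.exp_sum, hB.trace_eq_sum_eigenvalues, Finset.sum_add_distrib, Finset.mul_sum]
          simp
          ring

lemma measure_quadratic_stdGaussian_le {B : Matrix (Fin n) (Fin n) ℝ} (hB : B.IsHermitian)
    {K ε t : ℝ} (hK : ∀ u : Fin n → ℝ, |u ⬝ᵥ B *ᵥ u| ≤ K * (u ⬝ᵥ u)) (ht0 : 0 ≤ t)
    (ht : t * K ≤ 1 / 4) (hε : 8 * t * K ^ 2 ≤ ε) :
    (stdGaussian (EuclideanSpace ℝ (Fin n))).real
      {z | ε * n ≤ |z.ofLp ⬝ᵥ B *ᵥ z.ofLp - B.trace|} ≤ 2 * Real.exp (-(t * ε / 2)) ^ n := by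
  set μ := stdGaussian (EuclideanSpace ℝ (Fin n))
  set q : EuclideanSpace ℝ (Fin n) → ℝ := fun z => z.ofLp ⬝ᵥ B *ᵥ z.ofLp
  have hn : (0 : ℝ) ≤ n := n.cast_nonneg
  obtain ⟨i1, m1⟩ := mgf_quadratic_stdGaussian hB hK (t := t) (by rwa [abs_of_nonneg ht0])
  obtain ⟨i2, m2⟩ := mgf_quadratic_stdGaussian hB hK (t := -t)
    (by rwa [abs_neg, abs_of_nonneg ht0])
  -- The condition `8 t K² ≤ ε` lets the second-order term consume only half of the Chernoff gain `t
  -- ε n`.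
  have hexp : 4 * t ^ 2 * K ^ 2 * n ≤ t * ε / 2 * n := by
    apply mul_le_mul_of_nonneg_right _ hn
    nlinarith
  have h1 : μ.real {z | B.trace + ε * n ≤ q z} ≤ Real.exp (-(t * ε / 2)) ^ n := by
    refine (measure_ge_le_exp_mul_mgf _ ht0 i1).trans
      ((mul_le_mul_of_nonneg_left m1 (Real.exp_pos _).le).trans ?_)
    rw [← Real.exp_add, ← Real.exp_nat_mul, Real.exp_le_exp]
    linarith
  have h2 : μ.real {z | q z ≤ B.trace - ε * n} ≤ Real.exp (-(t * ε / 2)) ^ n := by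
    refine (measure_le_le_exp_mul_mgf _ (neg_nonpos.2 ht0) i2).trans
      ((mul_le_mul_of_nonneg_left m2 (Real.exp_pos _).le).trans ?_)
    rw [← Real.exp_add, ← Real.exp_nat_mul, Real.exp_le_exp]
    linarith
  have hsub : {z | ε * n ≤ |q z - B.trace|} ⊆
      {z | B.trace + ε * n ≤ q z} ∪ {z | q z ≤ B.trace - ε * n} := by
    intro z hz
    rcases le_abs.1 (show ε * n ≤ |q z - B.trace| from hz) with h | h
    · left; simp only [mem_ofPred_eq]; linarith
    · right; simp only [mem_ofPred_eq]; linarith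
  refine (measureReal_mono hsub).trans ((measureReal_union_le _ _).trans ?_)
  linarith

lemma measurableSet_quadratic (m : Fin n → ℝ) (B : Matrix (Fin n) (Fin n) ℝ) (a c : ℝ) :
    MeasurableSet {y : EuclideanSpace ℝ (Fin n) |
      a ≤ |(y.ofLp - m) ⬝ᵥ B *ᵥ (y.ofLp - m) - c|} := by
  apply measurableSet_le measurable_const
  apply Continuous.measurable
  simp only [dotProduct, Matrix.mulVec]
  fun_prop

open scoped MatrixOrder in
-- With `R = √V`, the centered vector is `R z` for a standard Gaussian `z`. The standard case
-- applies to `R B R`, whose quadratic form is bounded by `K κ` and whose trace is that of `B V`.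
lemma measure_quadratic_multivariateGaussian_le {m : Fin n → ℝ} {V B : Matrix (Fin n) (Fin n) ℝ}
    (hV : V.PosSemidef) (hB : B.IsHermitian) {κ K ε t : ℝ} (hK0 : 0 ≤ K)
    (hκ : ∀ u : Fin n → ℝ, u ⬝ᵥ V *ᵥ u ≤ κ * (u ⬝ᵥ u))
    (hK : ∀ u : Fin n → ℝ, |u ⬝ᵥ B *ᵥ u| ≤ K * (u ⬝ᵥ u)) (ht0 : 0 ≤ t)
    (ht : t * (K * κ) ≤ 1 / 4) (hε : 8 * t * (K * κ) ^ 2 ≤ ε) :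
    (multivariateGaussian (WithLp.toLp 2 m) V).real
      {y | ε * n ≤ |(y.ofLp - m) ⬝ᵥ B *ᵥ (y.ofLp - m) - (B * V).trace|} ≤
        2 * Real.exp (-(t * ε / 2)) ^ n := by
  set R := CFC.sqrt V
  have hRR : R * R = V := CFC.sqrt_mul_sqrt_self V hV.nonneg
  have hR : R.PosSemidef := Matrix.nonneg_iff_posSemidef.1 (CFC.sqrt_nonneg V)
  have hRT : Rᵀ = R := by simpa [Matrix.conjTranspose_eq_transpose_of_trivial] using hR.1.eq
  have hform : ∀ u v : Fin n → ℝ, u ⬝ᵥ (R * B * R) *ᵥ v = (R *ᵥ u) ⬝ᵥ B *ᵥ (R *ᵥ v) := by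
    intro u v
    rw [← Matrix.mulVec_mulVec, ← Matrix.mulVec_mulVec, Matrix.dotProduct_mulVec,
      ← Matrix.mulVec_transpose, hRT]
  have hH : (R * B * R).IsHermitian := by
    have hBT : Bᵀ = B := by simpa [Matrix.conjTranspose_eq_transpose_of_trivial] using hB.eq
    rw [Matrix.IsHermitian, Matrix.conjTranspose_eq_transpose_of_trivial, Matrix.transpose_mul,
      Matrix.transpose_mul, hRT, hBT, Matrix.mul_assoc]
  have hRK : ∀ u : Fin n → ℝ, |u ⬝ᵥ (R * B * R) *ᵥ u| ≤ K * κ * (u ⬝ᵥ u) := by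
    intro u
    rw [hform, mul_assoc]
    refine (hK _).trans (mul_le_mul_of_nonneg_left ?_ hK0)
    refine le_trans (le_of_eq ?_) (hκ u)
    rw [← hRR, ← Matrix.mulVec_mulVec, Matrix.dotProduct_mulVec u, ← Matrix.mulVec_transpose, hRT]
  have hmeas : Measurable fun z : EuclideanSpace ℝ (Fin n) =>
      WithLp.toLp 2 m + Matrix.toEuclideanCLM (𝕜 := ℝ) R z := by fun_prop
  have := measure_quadratic_stdGaussian_le hH hRK ht0 ht hε
  rw [multivariateGaussian, measureReal_def, Measure.map_apply hmeas (measurableSet_quadratic m B _ _), ← measureReal_def]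
  have htr : (R * B * R).trace = (B * V).trace := by
    rw [Matrix.mul_assoc, Matrix.trace_mul_comm, Matrix.mul_assoc, hRR]
  refine le_trans (le_of_eq ?_) this
  congr 1
  ext z
  simp only [mem_preimage, mem_ofPred_eq, WithLp.ofLp_add, Matrix.ofLp_toEuclideanCLM,
    add_sub_cancel_left, htr, hform]

/-- The deviation probabilities decay geometrically in `n`, so Borel–Cantelli applies for each
tolerance `1 / (k + 1)`. No relation between the vectors for different `n` is needed. -/
lemma ae_tendsto_quadratic {Ω : Type*} [MeasurableSpace Ω] {P : Measure Ω}
    {Y : (n : ℕ) → Ω → EuclideanSpace ℝ (Fin n)} {m : (n : ℕ) → Fin n → ℝ}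
    {V B : (n : ℕ) → Matrix (Fin n) (Fin n) ℝ} {κ K : ℝ}
    (hY : ∀ᶠ n in atTop, HasLaw (Y n) (multivariateGaussian (WithLp.toLp 2 (m n)) (V n)) P)
    (hV : ∀ᶠ n in atTop, (V n).PosSemidef)
    (hκ : ∀ᶠ n in atTop, ∀ u : Fin n → ℝ, u ⬝ᵥ V n *ᵥ u ≤ κ * (u ⬝ᵥ u))
    (hB : ∀ᶠ n in atTop, (B n).IsHermitian)
    (hK : ∀ᶠ n in atTop, ∀ u : Fin n → ℝ, |u ⬝ᵥ B n *ᵥ u| ≤ K * (u ⬝ᵥ u)) :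
    ∀ᵐ ω ∂P, Tendsto (fun n : ℕ => (((Y n ω).ofLp - m n) ⬝ᵥ B n *ᵥ ((Y n ω).ofLp - m n) -
      (B n * V n).trace) / n) atTop (nhds 0) := by
  wlog hK0 : 0 < K generalizing K
  · refine this (K := 1) ?_ one_pos
    filter_upwards [hK] with n h u
    refine (h u).trans (mul_le_mul_of_nonneg_right (by linarith) ?_)
    exact Finset.sum_nonneg fun i _ => mul_self_nonneg _
  wlog hκ0 : 0 < κ generalizing κ
  · refine this (κ := 1) ?_ one_pos
    filter_upwards [hκ] with n h u
    refine (h u).trans (mul_le_mul_of_nonneg_right (by linarith) ?_)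
    exact Finset.sum_nonneg fun i _ => mul_self_nonneg _
  have main : ∀ k : ℕ, ∀ᵐ ω ∂P, ∀ᶠ n : ℕ in atTop,
      |((Y n ω).ofLp - m n) ⬝ᵥ B n *ᵥ ((Y n ω).ofLp - m n) - (B n * V n).trace| <
        1 / ((k : ℝ) + 1) * n := by
    intro k
    set ε : ℝ := 1 / ((k : ℝ) + 1)
    have hε : 0 < ε := by positivity
    have hM : 0 < K * κ := by positivity
    -- The largest `t` which meets both conditions of the deviation bound.
    set t : ℝ := min (1 / (4 * (K * κ))) (ε / (8 * (K * κ) ^ 2))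
    have ht0 : 0 < t := by positivity
    have ht1 : t * (K * κ) ≤ 1 / 4 := by
      refine (mul_le_mul_of_nonneg_right (min_le_left _ _) hM.le).trans (le_of_eq ?_)
      field_simp
    have ht2 : 8 * t * (K * κ) ^ 2 ≤ ε := by
      have : t * (8 * (K * κ) ^ 2) ≤ ε :=
        (mul_le_mul_of_nonneg_right (min_le_right _ _) (by positivity)).trans
          (le_of_eq (by field_simp))
      linarith
    obtain ⟨N, hN⟩ := eventually_atTop.1 (hY.and (hV.and (hκ.and (hB.and hK))))
    have hr : Real.exp (-(t * ε / 2)) < 1 := by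
      rw [Real.exp_lt_one_iff]
      have := mul_pos ht0 hε
      linarith
    -- The assumptions hold only from `N` on, so Borel–Cantelli is applied to the tail sequence.
    have hsum : Summable fun n : ℕ => 2 * Real.exp (-(t * ε / 2)) ^ (n + N) := by
      apply Summable.mul_left
      exact (summable_nat_add_iff N).2 (summable_geometric_of_lt_one (Real.exp_pos _).le hr)
    have hbd : ∀ n : ℕ, P {ω | ε * (n + N : ℕ) ≤ |((Y (n + N) ω).ofLp - m (n + N)) ⬝ᵥ
        B (n + N) *ᵥ ((Y (n + N) ω).ofLp - m (n + N)) - (B (n + N) * V (n + N)).trace|} ≤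
        ENNReal.ofReal (2 * Real.exp (-(t * ε / 2)) ^ (n + N)) := by
      intro n
      obtain ⟨h1, h2, h3, h4, h5⟩ := hN (n + N) (Nat.le_add_left _ _)
      have h6 := measure_quadratic_multivariateGaussian_le (m := m (n + N)) h2 h4 hK0.le h3 h5
        ht0.le ht1 ht2
      refine le_trans (le_of_eq ?_) (ENNReal.ofReal_le_ofReal h6)
      rw [ofReal_measureReal, ← h1.map_eq,
        Measure.map_apply_of_aemeasurable h1.aemeasurable (measurableSet_quadratic _ _ _ _)]
      rfl
    have := ae_eventually_notMem
      (ne_top_of_le_ne_top hsum.tsum_ofReal_ne_top (ENNReal.tsum_le_tsum hbd))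
    filter_upwards [this] with ω hω
    obtain ⟨N', hN'⟩ := eventually_atTop.1 hω
    filter_upwards [eventually_ge_atTop (N' + N)] with n hn
    obtain ⟨l, rfl⟩ := Nat.exists_eq_add_of_le' (le_trans (Nat.le_add_left _ _) hn)
    exact not_le.1 (hN' l (by omega))
  filter_upwards [ae_all_iff.2 main] with ω hω
  rw [Metric.tendsto_atTop']
  intro ε hε
  obtain ⟨k, hk⟩ := exists_nat_one_div_lt hε
  obtain ⟨N, hN⟩ := eventually_atTop.1 (hω k)
  refine ⟨N, fun n hn => ?_⟩
  have hn0 : (0 : ℝ) < n := by exact_mod_cast (Nat.zero_le _).trans_lt hn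
  rw [dist_zero_right, Real.norm_eq_abs, abs_div, abs_of_pos hn0, div_lt_iff₀ hn0]
  exact (hN n hn.le).trans (mul_lt_mul_of_pos_right hk hn0)

end Concentration

/-! ### Euclidean norms of coordinate vectors -/

/-- The Euclidean norm of a coordinate vector. -/
def vecNorm {ι : Type*} [Fintype ι] (u : ι → ℝ) : ℝ := ‖WithLp.toLp 2 u‖

section VecNorm

variable {ι : Type*} [Fintype ι]

lemma vecNorm_nonneg (u : ι → ℝ) : 0 ≤ vecNorm u := norm_nonneg _

lemma vecNorm_sq (u : ι → ℝ) : vecNorm u ^ 2 = u ⬝ᵥ u := by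
  rw [vecNorm, EuclideanSpace.real_norm_sq_eq]
  simp [dotProduct, sq]

lemma zero_le_dotProduct_self (u : ι → ℝ) : 0 ≤ u ⬝ᵥ u := by
  rw [← vecNorm_sq]
  positivity

lemma vecNorm_add_le (u v : ι → ℝ) : vecNorm (u + v) ≤ vecNorm u + vecNorm v := by
  simpa [vecNorm] using norm_add_le (WithLp.toLp 2 u) (WithLp.toLp 2 v)

lemma vecNorm_sub_le (u v : ι → ℝ) : vecNorm (u - v) ≤ vecNorm u + vecNorm v := by
  simpa [vecNorm] using norm_sub_le (WithLp.toLp 2 u) (WithLp.toLp 2 v)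

lemma vecNorm_smul (a : ℝ) (u : ι → ℝ) : vecNorm (a • u) = |a| * vecNorm u := by
  simpa [vecNorm] using norm_smul a (WithLp.toLp 2 u)

lemma abs_dotProduct_le (u v : ι → ℝ) : |u ⬝ᵥ v| ≤ vecNorm u * vecNorm v := by
  have := abs_real_inner_le_norm (WithLp.toLp 2 u) (WithLp.toLp 2 v)
  rw [EuclideanSpace.inner_toLp_toLp] at this
  simpa [vecNorm, dotProduct_comm] using this

lemma vecNorm_le_of_sq_le {κ : Type*} [Fintype κ] {u : ι → ℝ} {v : κ → ℝ} (h : u ⬝ᵥ u ≤ v ⬝ᵥ v) :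
    vecNorm u ≤ vecNorm v := by
  rw [← vecNorm_sq, ← vecNorm_sq] at h
  exact (sq_le_sq₀ (vecNorm_nonneg _) (vecNorm_nonneg _)).1 h

lemma mulVec_dotProduct {κ : Type*} [Fintype κ] (M : Matrix ι κ ℝ) (u : κ → ℝ) (v : ι → ℝ) :
    (M *ᵥ u) ⬝ᵥ v = u ⬝ᵥ Mᵀ *ᵥ v := by
  rw [Matrix.mulVec_transpose, dotProduct_comm, Matrix.dotProduct_mulVec, dotProduct_comm]

/-- The trace of `M * Mᵀ` is monotone in the norms of the images of the columns. -/
lemma trace_mul_transpose_le {κ ν : Type*} [Fintype κ] [Fintype ν] (M : Matrix ν ι ℝ)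
    (F : Matrix ι κ ℝ) {c : ℝ}
    (h : ∀ u : ι → ℝ, (M *ᵥ u) ⬝ᵥ (M *ᵥ u) ≤ c * (u ⬝ᵥ u)) :
    ((M * F) * (M * F)ᵀ).trace ≤ c * (F * Fᵀ).trace := by
  have hcol : ∀ j, (M * F).col j = M *ᵥ F.col j := by
    intro j
    ext i
    simp [Matrix.mul_apply, Matrix.mulVec, dotProduct]
  have e1 : ((M * F) * (M * F)ᵀ).trace = ∑ j, (M *ᵥ F.col j) ⬝ᵥ (M *ᵥ F.col j) := by
    simp only [Matrix.trace, Matrix.diag, ← hcol]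
    simp only [Matrix.mul_apply, Matrix.transpose_apply, dotProduct, Matrix.col_apply]
    exact Finset.sum_comm
  have e2 : (F * Fᵀ).trace = ∑ j, F.col j ⬝ᵥ F.col j := by
    simp only [Matrix.trace, Matrix.diag, Matrix.mul_apply, Matrix.transpose_apply, dotProduct,
      Matrix.col_apply]
    exact Finset.sum_comm
  rw [e1, e2, Finset.mul_sum]
  exact Finset.sum_le_sum fun j _ => h _

end VecNorm

/-! ### The shift matrix and the inverse of the autoregressive filter -/

/-- The lower shift matrix. -/
def shiftMat (n : ℕ) : Matrix (Fin n) (Fin n) ℝ :=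
  Matrix.of fun t k => if (k : ℕ) + 1 = t then 1 else 0

lemma vecNorm_shiftMat_mulVec_le {n : ℕ} (u : Fin n → ℝ) :
    vecNorm (shiftMat n *ᵥ u) ≤ vecNorm u := by
  apply vecNorm_le_of_sq_le
  cases n with
  | zero => simp
  | succ m =>
    have h : shiftMat (m + 1) *ᵥ u = Fin.cons 0 (fun i : Fin m => u i.castSucc) := by
      ext t
      refine Fin.cases ?_ (fun i => ?_) t
      · simp [shiftMat, Matrix.mulVec, dotProduct]
      · simp only [shiftMat, Matrix.mulVec, dotProduct, Matrix.of_apply, Fin.cons_succ, ite_mul,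
          one_mul, zero_mul, Fin.val_succ, add_left_inj]
        rw [Finset.sum_eq_single i.castSucc]
        · simp
        · intro j _ hj
          rw [if_neg]
          exact fun h => hj (Fin.ext h)
        · simp
    rw [h]
    simp only [dotProduct]
    rw [Fin.sum_univ_succ, Fin.sum_univ_castSucc (fun i => u i * u i)]
    simp only [Fin.cons_zero, Fin.cons_succ]
    nlinarith [mul_self_nonneg (u (Fin.last m))]

/-- Adjoints of contractions are contractions: `‖N'u‖² = u · N N'u ≤ ‖u‖ ‖N'u‖`. -/
lemma vecNorm_shiftMat_transpose_mulVec_le {n : ℕ} (u : Fin n → ℝ) :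
    vecNorm ((shiftMat n)ᵀ *ᵥ u) ≤ vecNorm u := by
  have h : vecNorm ((shiftMat n)ᵀ *ᵥ u) ^ 2 ≤ vecNorm u * vecNorm ((shiftMat n)ᵀ *ᵥ u) := by
    rw [vecNorm_sq, mulVec_dotProduct, Matrix.transpose_transpose]
    refine (le_abs_self _).trans ((abs_dotProduct_le _ _).trans ?_)
    exact mul_le_mul_of_nonneg_left (vecNorm_shiftMat_mulVec_le _) (vecNorm_nonneg _)
  by_contra! hc
  nlinarith [vecNorm_nonneg u, vecNorm_nonneg ((shiftMat n)ᵀ *ᵥ u)]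

/-- The inverse `1 - ρ N` of the autoregressive filter, `N` being the lower shift. -/
def ar1Inv (n : ℕ) (ρ : ℝ) : Matrix (Fin n) (Fin n) ℝ := 1 - ρ • shiftMat n

lemma ar1Inv_mulVec {n : ℕ} (ρ : ℝ) (u : Fin n → ℝ) :
    ar1Inv n ρ *ᵥ u = u - ρ • (shiftMat n *ᵥ u) := by
  rw [ar1Inv, Matrix.sub_mulVec, Matrix.one_mulVec, Matrix.smul_mulVec]

lemma ar1Inv_transpose_mulVec {n : ℕ} (ρ : ℝ) (u : Fin n → ℝ) :
    (ar1Inv n ρ)ᵀ *ᵥ u = u - ρ • ((shiftMat n)ᵀ *ᵥ u) := by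
  rw [ar1Inv, Matrix.transpose_sub, Matrix.transpose_one, Matrix.transpose_smul,
    Matrix.sub_mulVec, Matrix.one_mulVec, Matrix.smul_mulVec]

/-- Two triangle inequalities. With `v = N u` or `v = N' u` they make the whitening invertible with
constants that depend neither on `n` nor on `ρ`. -/
lemma vecNorm_sub_smul_bounds {n : ℕ} {ρ γ : ℝ} (hγ : 0 ≤ γ) (hρ : |ρ| ≤ 1 - γ) {u v : Fin n → ℝ}
    (h : vecNorm v ≤ vecNorm u) :
    γ * vecNorm u ≤ vecNorm (u - ρ • v) ∧ vecNorm (u - ρ • v) ≤ 2 * vecNorm u := by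
  have h1 := vecNorm_sub_le u (ρ • v)
  have h2 := vecNorm_add_le (u - ρ • v) (ρ • v)
  rw [sub_add_cancel] at h2
  rw [vecNorm_smul] at h1 h2
  have h3 : |ρ| * vecNorm v ≤ (1 - γ) * vecNorm u :=
    mul_le_mul hρ h (vecNorm_nonneg _) ((abs_nonneg _).trans hρ)
  have := mul_nonneg hγ (vecNorm_nonneg u)
  constructor <;> linarith

lemma le_vecNorm_ar1Inv {n : ℕ} {ρ γ : ℝ} (hγ : 0 ≤ γ) (hρ : |ρ| ≤ 1 - γ) (u : Fin n → ℝ) :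
    γ * vecNorm u ≤ vecNorm (ar1Inv n ρ *ᵥ u) := by
  rw [ar1Inv_mulVec]
  exact (vecNorm_sub_smul_bounds hγ hρ (vecNorm_shiftMat_mulVec_le u)).1

lemma vecNorm_ar1Inv_le {n : ℕ} {ρ : ℝ} (hρ : |ρ| ≤ 1) (u : Fin n → ℝ) :
    vecNorm (ar1Inv n ρ *ᵥ u) ≤ 2 * vecNorm u := by
  rw [ar1Inv_mulVec]
  exact (vecNorm_sub_smul_bounds le_rfl (by simpa using hρ) (vecNorm_shiftMat_mulVec_le u)).2

lemma le_vecNorm_ar1Inv_transpose {n : ℕ} {ρ γ : ℝ} (hγ : 0 ≤ γ) (hρ : |ρ| ≤ 1 - γ)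
    (u : Fin n → ℝ) : γ * vecNorm u ≤ vecNorm ((ar1Inv n ρ)ᵀ *ᵥ u) := by
  rw [ar1Inv_transpose_mulVec]
  exact (vecNorm_sub_smul_bounds hγ hρ (vecNorm_shiftMat_transpose_mulVec_le u)).1

lemma vecNorm_ar1Inv_transpose_le {n : ℕ} {ρ : ℝ} (hρ : |ρ| ≤ 1) (u : Fin n → ℝ) :
    vecNorm ((ar1Inv n ρ)ᵀ *ᵥ u) ≤ 2 * vecNorm u := by
  rw [ar1Inv_transpose_mulVec]
  exact (vecNorm_sub_smul_bounds le_rfl (by simpa using hρ)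
    (vecNorm_shiftMat_transpose_mulVec_le u)).2

lemma ar1Inv_mul_ar1Filter (n : ℕ) (ρ : ℝ) : ar1Inv n ρ * ar1Filter n ρ = 1 := by
  ext t k
  rw [ar1Inv, Matrix.sub_mul, Matrix.one_mul, Matrix.smul_mul, Matrix.sub_apply,
    Matrix.smul_apply, smul_eq_mul, Matrix.mul_apply]
  simp only [shiftMat, ar1Filter, Matrix.of_apply, ite_mul, one_mul, zero_mul, Matrix.one_apply]
  obtain ⟨t, ht⟩ := t
  cases t with
  | zero =>
    obtain ⟨k, hk⟩ := k
    cases k <;> simp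
  | succ t =>
    rw [Finset.sum_eq_single ⟨t, Nat.lt_of_succ_lt ht⟩]
    · obtain ⟨k, hk⟩ := k
      simp only [Fin.mk_le_mk, Fin.mk.injEq, if_true]
      rcases lt_trichotomy k (t + 1) with h | h | h
      · rw [if_pos h.le, if_pos (Nat.lt_succ_iff.1 h), if_neg h.ne', Nat.succ_sub (by omega),
          pow_succ]
        ring
      · simp [h]
      · rw [if_neg (by omega), if_neg (by omega), if_neg (by omega)]
        ring
    · intro j _ hj
      rw [if_neg]
      exact fun h => hj (Fin.ext (Nat.succ_injective h))
    · simp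

lemma ar1Filter_mul_ar1Inv (n : ℕ) (ρ : ℝ) : ar1Filter n ρ * ar1Inv n ρ = 1 :=
  mul_eq_one_comm.1 (ar1Inv_mul_ar1Filter n ρ)

lemma det_ar1Filter (n : ℕ) (ρ : ℝ) : (ar1Filter n ρ).det = 1 := by
  rw [Matrix.det_of_isLowerTriangular]
  · simp [ar1Filter]
  · intro i j hij
    have : i < j := hij
    simp [ar1Filter, this]

lemma det_ar1Inv (n : ℕ) (ρ : ℝ) : (ar1Inv n ρ).det = 1 := by
  have := congrArg Matrix.det (ar1Inv_mul_ar1Filter n ρ)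
  rwa [Matrix.det_mul, det_ar1Filter, mul_one, Matrix.det_one] at this

/-! ### Projections on column spaces -/

/-- The orthogonal projection on the column space of a matrix of full column rank. -/
def colProj {m k : Type*} [Fintype m] [Fintype k] [DecidableEq k] (Z : Matrix m k ℝ) :
    Matrix m m ℝ := Z * (Zᵀ * Z)⁻¹ * Zᵀ

section ColProj

variable {m k : Type*} [Fintype m] [Fintype k] [DecidableEq k] (Z : Matrix m k ℝ)

lemma colProj_transpose : (colProj Z)ᵀ = colProj Z := by
  simp only [colProj, Matrix.transpose_mul, Matrix.transpose_transpose,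
    Matrix.transpose_nonsing_inv, Matrix.mul_assoc]

/-- The inverse of a singular matrix is zero by convention. The projection identities and bounds
below therefore need no rank condition, which matters because the `n` from which `Z_s(ρ)` has full
rank is given for each `ρ` separately. -/
lemma colProj_eq_zero (h : (Zᵀ * Z).det = 0) : colProj Z = 0 := by
  rw [colProj, Matrix.nonsing_inv_apply_not_isUnit _ (by simpa using h)]
  simp

lemma transpose_mul_colProj (h : (Zᵀ * Z).det ≠ 0) : Zᵀ * colProj Z = Zᵀ := by
  rw [colProj, Matrix.mul_assoc Z, ← Matrix.mul_assoc Zᵀ, ← Matrix.mul_assoc,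
    Matrix.mul_nonsing_inv _ (isUnit_iff_ne_zero.2 h), Matrix.one_mul]

lemma colProj_mul_self : colProj Z * colProj Z = colProj Z := by
  by_cases h : (Zᵀ * Z).det = 0
  · simp [colProj_eq_zero Z h]
  · conv_lhs => enter [1]; rw [colProj]
    rw [Matrix.mul_assoc, transpose_mul_colProj Z h, colProj]

lemma trace_colProj_le : (colProj Z).trace ≤ Fintype.card k := by
  by_cases h : (Zᵀ * Z).det = 0
  · simp [colProj_eq_zero Z h]
  · rw [colProj, Matrix.mul_assoc, Matrix.trace_mul_comm, Matrix.mul_assoc,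
      Matrix.nonsing_inv_mul _ (isUnit_iff_ne_zero.2 h), Matrix.trace_one]

lemma colProj_mulVec_dotProduct (u : m → ℝ) :
    (colProj Z *ᵥ u) ⬝ᵥ (colProj Z *ᵥ u) = u ⬝ᵥ colProj Z *ᵥ u := by
  rw [mulVec_dotProduct, colProj_transpose, Matrix.mulVec_mulVec, colProj_mul_self]

lemma vecNorm_colProj_le (u : m → ℝ) : vecNorm (colProj Z *ᵥ u) ≤ vecNorm u := by
  have h : vecNorm (colProj Z *ᵥ u) ^ 2 ≤ vecNorm u * vecNorm (colProj Z *ᵥ u) := by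
    rw [vecNorm_sq, colProj_mulVec_dotProduct]
    exact (le_abs_self _).trans (abs_dotProduct_le _ _)
  by_contra! hc
  nlinarith [vecNorm_nonneg u, vecNorm_nonneg (colProj Z *ᵥ u)]

end ColProj

/-! ### The whitened covariance matrix -/

section Whitened

variable {p : ℕ} (x : ℕ → Fin p → ℝ) (s : Finset (Fin p)) (n : ℕ) (ρ : ℝ)

lemma designZ_zero : designZ x s n 0 = Matrix.of fun (t : Fin n) (j : s) => x t j := by
  ext t j
  simp only [designZ, Matrix.of_apply]
  rw [Finset.sum_eq_single (t : ℕ)]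
  · simp
  · intro k hk hkt
    have := Finset.mem_range.1 hk
    rw [zero_pow (by omega), zero_mul]
  · simp

/-- At `ρ = 0` the design is the raw covariate matrix `X_s`, because `0 ^ 0 = 1`; the filter then
produces `Z_s(ρ)`. -/
lemma designZ_eq : designZ x s n ρ = ar1Filter n ρ * designZ x s n 0 := by
  ext t j
  rw [designZ_zero, Matrix.mul_apply]
  simp only [designZ, ar1Filter, Matrix.of_apply, ite_mul, zero_mul, Fin.le_def]
  rw [Fin.sum_univ_eq_sum_range
    (fun k => if k ≤ (t : ℕ) then ρ ^ ((t : ℕ) - k) * x k j else 0) n, ← Finset.sum_filter]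
  refine Finset.sum_congr ?_ fun _ _ => rfl
  ext k
  have := t.2
  simp only [Finset.mem_range, Finset.mem_filter]
  omega

lemma ar1Inv_mul_designZ : ar1Inv n ρ * designZ x s n ρ = designZ x s n 0 := by
  rw [designZ_eq, ← Matrix.mul_assoc, ar1Inv_mul_ar1Filter, Matrix.one_mul]

/-- The contribution of the prior of the regression coefficients to the covariance matrix after
whitening of the errors. -/
def whitenedProj : Matrix (Fin n) (Fin n) ℝ :=
  ar1Inv n ρ * colProj (designZ x s n ρ) * (ar1Inv n ρ)ᵀ

lemma whitenedProj_transpose : (whitenedProj x s n ρ)ᵀ = whitenedProj x s n ρ := by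
  simp only [whitenedProj, Matrix.transpose_mul, Matrix.transpose_transpose, colProj_transpose,
    Matrix.mul_assoc]

lemma dotProduct_whitenedProj_mulVec (u v : Fin n → ℝ) :
    u ⬝ᵥ whitenedProj x s n ρ *ᵥ v =
      ((ar1Inv n ρ)ᵀ *ᵥ u) ⬝ᵥ colProj (designZ x s n ρ) *ᵥ ((ar1Inv n ρ)ᵀ *ᵥ v) := by
  rw [whitenedProj, ← Matrix.mulVec_mulVec, ← Matrix.mulVec_mulVec, mulVec_dotProduct,
    Matrix.transpose_transpose]

lemma dotProduct_whitenedProj_nonneg (u : Fin n → ℝ) : 0 ≤ u ⬝ᵥ whitenedProj x s n ρ *ᵥ u := by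
  rw [dotProduct_whitenedProj_mulVec, ← colProj_mulVec_dotProduct]
  exact zero_le_dotProduct_self _

variable {ρ}

lemma dotProduct_whitenedProj_le (hρ : |ρ| ≤ 1) (u : Fin n → ℝ) :
    u ⬝ᵥ whitenedProj x s n ρ *ᵥ u ≤ 4 * (u ⬝ᵥ u) := by
  rw [dotProduct_whitenedProj_mulVec, ← colProj_mulVec_dotProduct, ← vecNorm_sq, ← vecNorm_sq]
  have h1 := vecNorm_colProj_le (designZ x s n ρ) ((ar1Inv n ρ)ᵀ *ᵥ u)
  have h2 := vecNorm_ar1Inv_transpose_le hρ u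
  calc _ ≤ (2 * vecNorm u) ^ 2 := pow_le_pow_left₀ (vecNorm_nonneg _) (h1.trans h2) 2
    _ = _ := by ring

/-- In operator form `S² ≤ 4 S`: with `w = P A'u`, the left side is `‖A w‖² ≤ 4 ‖w‖²`, and `‖w‖² = u
· S u`. -/
lemma whitenedProj_mulVec_sq_le (hρ : |ρ| ≤ 1) (u : Fin n → ℝ) :
    (whitenedProj x s n ρ *ᵥ u) ⬝ᵥ (whitenedProj x s n ρ *ᵥ u) ≤
      4 * (u ⬝ᵥ whitenedProj x s n ρ *ᵥ u) := by
  rw [dotProduct_whitenedProj_mulVec x s n ρ u u, ← colProj_mulVec_dotProduct, ← vecNorm_sq, ← vecNorm_sq]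
  rw [whitenedProj, ← Matrix.mulVec_mulVec, ← Matrix.mulVec_mulVec]
  have h2 := vecNorm_ar1Inv_le hρ (colProj (designZ x s n ρ) *ᵥ ((ar1Inv n ρ)ᵀ *ᵥ u))
  calc _ ≤ (2 * vecNorm (colProj (designZ x s n ρ) *ᵥ ((ar1Inv n ρ)ᵀ *ᵥ u))) ^ 2 :=
        pow_le_pow_left₀ (vecNorm_nonneg _) h2 2
    _ = _ := by ring

lemma trace_whitenedProj_le (hρ : |ρ| ≤ 1) : (whitenedProj x s n ρ).trace ≤ 4 * p := by
  have h : whitenedProj x s n ρ = (ar1Inv n ρ * colProj (designZ x s n ρ)) *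
      (ar1Inv n ρ * colProj (designZ x s n ρ))ᵀ := by
    rw [Matrix.transpose_mul, colProj_transpose, ← Matrix.mul_assoc,
      Matrix.mul_assoc _ (colProj _) (colProj _), colProj_mul_self, whitenedProj]
  rw [h]
  refine (trace_mul_transpose_le (c := 4) _ _ fun u => ?_).trans ?_
  · rw [← vecNorm_sq, ← vecNorm_sq]
    calc _ ≤ (2 * vecNorm u) ^ 2 := pow_le_pow_left₀ (vecNorm_nonneg _) (vecNorm_ar1Inv_le hρ u) 2
      _ = _ := by ring
  · rw [colProj_transpose, colProj_mul_self]
    have h1 := trace_colProj_le (designZ x s n ρ)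
    have h2 : (Fintype.card s : ℝ) ≤ p := by
      rw [Fintype.card_coe]
      exact_mod_cast (Finset.card_le_univ s).trans (by simp)
    linarith

lemma trace_whitenedProj_nonneg (ρ : ℝ) : 0 ≤ (whitenedProj x s n ρ).trace := by
  apply Finset.sum_nonneg
  intro i _
  simpa using dotProduct_whitenedProj_nonneg x s n ρ (Pi.single i 1)

/-- Source of the uniformity in `ρ`: since `A Z_s(ρ) = X_s`, the matrix `S` ends in the factor
`X_s'`, so it is unchanged by the projection on the columns of `X_s`, which is the same for all `ρ`.
Only `X_s` itself has to have full rank. -/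
lemma whitenedProj_mul_colProj (ρ : ℝ)
    (h : ((designZ x s n 0)ᵀ * designZ x s n 0).det ≠ 0) :
    whitenedProj x s n ρ * colProj (designZ x s n 0) = whitenedProj x s n ρ := by
  have : whitenedProj x s n ρ = ar1Inv n ρ * (designZ x s n ρ *
      ((designZ x s n ρ)ᵀ * designZ x s n ρ)⁻¹) * (designZ x s n 0)ᵀ := by
    rw [← ar1Inv_mul_designZ x s n ρ, whitenedProj, colProj, Matrix.transpose_mul]
    simp only [Matrix.mul_assoc]
  rw [this, Matrix.mul_assoc, transpose_mul_colProj _ h]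

end Whitened

/-! ### Determinant and inverse of `1 + g S` -/

section Precision

variable {n : ℕ}

lemma posDef_one_add_smul {S : Matrix (Fin n) (Fin n) ℝ} (hS : Sᵀ = S)
    (hS0 : ∀ u : Fin n → ℝ, 0 ≤ u ⬝ᵥ S *ᵥ u) {g : ℝ} (hg : 0 ≤ g) :
    (1 + g • S).PosDef := by
  refine Matrix.PosDef.one.add_posSemidef (Matrix.PosSemidef.smul ?_ hg)
  refine Matrix.PosSemidef.of_dotProduct_mulVec_nonneg ?_ fun u => by simpa using hS0 u
  rwa [Matrix.IsHermitian, Matrix.conjTranspose_eq_transpose_of_trivial]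

/-- All eigenvalues `λ` of `1 + g S` are at least one and satisfy `λ ≤ exp (λ - 1)`; the numbers `λ
- 1` sum to `g` times the trace of `S`. A bounded trace thus bounds the determinant in every
dimension. -/
lemma det_one_add_bounds {S : Matrix (Fin n) (Fin n) ℝ} (hS : Sᵀ = S)
    (hS0 : ∀ u : Fin n → ℝ, 0 ≤ u ⬝ᵥ S *ᵥ u) {g : ℝ} (hg : 0 ≤ g) :
    1 ≤ (1 + g • S).det ∧ (1 + g • S).det ≤ Real.exp (g * S.trace) := by
  have hM := (posDef_one_add_smul hS hS0 hg).isHermitian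
  have hev : ∀ i, 1 ≤ hM.eigenvalues i := by
    intro i
    set v := (hM.eigenvectorBasis i).ofLp
    have h1 : v ⬝ᵥ v = 1 := by
      rw [← vecNorm_sq, vecNorm]
      simp [v, hM.eigenvectorBasis.orthonormal.1 i]
    have h2 : v ⬝ᵥ (1 + g • S) *ᵥ v = hM.eigenvalues i := by
      rw [hM.mulVec_eigenvectorBasis i, dotProduct_smul]
      simp [v, h1]
    rw [← h2, Matrix.add_mulVec, Matrix.one_mulVec, dotProduct_add, h1, Matrix.smul_mulVec,
      dotProduct_smul, smul_eq_mul]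
    have := mul_nonneg hg (hS0 v)
    linarith
  have htr : g * S.trace = ∑ i, (hM.eigenvalues i - 1) := by
    have h := hM.trace_eq_sum_eigenvalues
    rw [Matrix.trace_add, Matrix.trace_smul, Matrix.trace_one] at h
    simp only [RCLike.ofReal_real_eq_id, id] at h
    rw [Finset.sum_sub_distrib, ← h]
    simp
  rw [hM.det_eq_prod_eigenvalues, htr, Real.exp_sum]
  simp only [RCLike.ofReal_real_eq_id, id]
  constructor
  · simpa using Finset.prod_le_prod (s := Finset.univ) (f := fun _ => (1 : ℝ))
      (fun _ _ => zero_le_one) fun i _ => hev i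
  · refine Finset.prod_le_prod (fun i _ => zero_le_one.trans (hev i)) fun i _ => ?_
    linarith [Real.add_one_le_exp (hM.eigenvalues i - 1)]

/-- Properties of the precision matrix `(1 + g S)⁻¹`: the quadratic form is at least
`(1 + 4 g)⁻¹`, and the complement `1 - (1 + g S)⁻¹` is a contraction with the column space
of `S`. -/
lemma precision_bounds {S R : Matrix (Fin n) (Fin n) ℝ} (hS : Sᵀ = S)
    (hS0 : ∀ u : Fin n → ℝ, 0 ≤ u ⬝ᵥ S *ᵥ u)
    (hS1 : ∀ u : Fin n → ℝ, u ⬝ᵥ S *ᵥ u ≤ 4 * (u ⬝ᵥ u))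
    (hS2 : ∀ u : Fin n → ℝ, (S *ᵥ u) ⬝ᵥ (S *ᵥ u) ≤ 4 * (u ⬝ᵥ S *ᵥ u))
    {g : ℝ} (hg : 0 ≤ g) (hR : S * R = S) :
    ((1 + g • S)⁻¹)ᵀ = (1 + g • S)⁻¹ ∧
    (∀ u : Fin n → ℝ, u ⬝ᵥ u ≤ (1 + 4 * g) * (u ⬝ᵥ (1 + g • S)⁻¹ *ᵥ u)) ∧
    (∀ u : Fin n → ℝ, u ⬝ᵥ (1 + g • S)⁻¹ *ᵥ u ≤ u ⬝ᵥ u) ∧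
    ∀ u v : Fin n → ℝ, |u ⬝ᵥ v - u ⬝ᵥ (1 + g • S)⁻¹ *ᵥ v| ≤ vecNorm u * vecNorm (R *ᵥ v) := by
  set D := (1 + g • S)⁻¹ with hD
  have hdet : IsUnit (1 + g • S).det :=
    isUnit_iff_ne_zero.2 (posDef_one_add_smul hS hS0 hg).det_pos.ne'
  have hDT : Dᵀ = D := by
    rw [hD, Matrix.transpose_nonsing_inv, Matrix.transpose_add, Matrix.transpose_one,
      Matrix.transpose_smul, hS]
  have hMD : (1 + g • S) * D = 1 := Matrix.mul_nonsing_inv _ hdet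
  have hDM : D * (1 + g • S) = 1 := Matrix.nonsing_inv_mul _ hdet
  -- With `w = D u` one has `u = w + g S w`, and all claims become inequalities between `‖w‖²`, `w ·
  -- S w` and `‖S w‖²`.
  have hu : ∀ u : Fin n → ℝ, u = D *ᵥ u + g • (S *ᵥ (D *ᵥ u)) := by
    intro u
    conv_lhs => rw [← Matrix.one_mulVec u, ← hMD, ← Matrix.mulVec_mulVec, Matrix.add_mulVec,
      Matrix.one_mulVec, Matrix.smul_mulVec]
  have huu : ∀ u : Fin n → ℝ, u ⬝ᵥ u = (D *ᵥ u) ⬝ᵥ (D *ᵥ u) +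
      2 * g * ((D *ᵥ u) ⬝ᵥ S *ᵥ (D *ᵥ u)) +
      g ^ 2 * ((S *ᵥ (D *ᵥ u)) ⬝ᵥ (S *ᵥ (D *ᵥ u))) := by
    intro u
    conv_lhs => rw [hu u]
    rw [dotProduct_add, add_dotProduct, add_dotProduct, dotProduct_smul, smul_dotProduct,
      smul_dotProduct, dotProduct_smul, dotProduct_comm (S *ᵥ (D *ᵥ u)) (D *ᵥ u)]
    simp only [smul_eq_mul]
    ring
  have huD : ∀ u : Fin n → ℝ, u ⬝ᵥ D *ᵥ u = (D *ᵥ u) ⬝ᵥ (D *ᵥ u) +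
      g * ((D *ᵥ u) ⬝ᵥ S *ᵥ (D *ᵥ u)) := by
    intro u
    conv_lhs => rw [dotProduct_comm]; enter [2]; rw [hu u]
    rw [dotProduct_add, dotProduct_smul, smul_eq_mul]
  refine ⟨hDT, fun u => ?_, fun u => ?_, fun u v => ?_⟩
  · rw [huu u, huD u]
    nlinarith [mul_le_mul_of_nonneg_left (hS1 (D *ᵥ u)) hg,
      mul_le_mul_of_nonneg_left (hS2 (D *ᵥ u)) (sq_nonneg g)]
  · rw [huu u, huD u]
    have h1 := mul_nonneg hg (hS0 (D *ᵥ u))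
    have h2 := mul_nonneg (sq_nonneg g) (zero_le_dotProduct_self (S *ᵥ (D *ᵥ u)))
    linarith
  -- `1 - D = g D S` inherits `S R = S`, so `R` can be moved onto `v`.
  · have hC : (1 - D) * R = 1 - D := by
      have : 1 - D = g • (D * S) := by
        rw [← hDM, Matrix.mul_add, Matrix.mul_one, add_sub_cancel_left, Matrix.mul_smul]
      rw [this, Matrix.smul_mul, Matrix.mul_assoc, hR]
    have hCT : (1 - D)ᵀ = 1 - D := by rw [Matrix.transpose_sub, Matrix.transpose_one, hDT]
    have h1 : u ⬝ᵥ v - u ⬝ᵥ D *ᵥ v = ((1 - D) *ᵥ u) ⬝ᵥ (R *ᵥ v) := by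
      rw [mulVec_dotProduct, hCT, Matrix.mulVec_mulVec, hC, Matrix.sub_mulVec, Matrix.one_mulVec,
        dotProduct_sub]
    rw [h1]
    refine (abs_dotProduct_le _ _).trans
      (mul_le_mul_of_nonneg_right (vecNorm_le_of_sq_le ?_) (vecNorm_nonneg _))
    have h2 : (1 - D) *ᵥ u = g • (S *ᵥ (D *ᵥ u)) := by
      rw [Matrix.sub_mulVec, Matrix.one_mulVec]
      exact sub_eq_of_eq_add' (hu u)
    rw [h2, huu u, smul_dotProduct, dotProduct_smul]
    simp only [smul_eq_mul]
    have h3 := mul_nonneg hg (hS0 (D *ᵥ u))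
    have h4 := zero_le_dotProduct_self (D *ᵥ u)
    nlinarith

end Precision

/-! ### The covariance matrix before and after whitening -/

section ScaleMat

variable {p : ℕ} (x : ℕ → Fin p → ℝ) (g : ℕ → ℝ) (s : Finset (Fin p)) (n : ℕ) (ρ : ℝ)

lemma ar1Inv_mul_scaleMat :
    ar1Inv n ρ * scaleMat x g s n ρ * (ar1Inv n ρ)ᵀ = 1 + g n • whitenedProj x s n ρ := by
  have h1 : scaleMat x g s n ρ = ar1Filter n ρ * (ar1Filter n ρ)ᵀ +
    g n • colProj (designZ x s n ρ) := rfl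
  rw [h1, Matrix.mul_add, Matrix.add_mul, ← Matrix.mul_assoc, ar1Inv_mul_ar1Filter, Matrix.one_mul,
    ← Matrix.transpose_mul, ar1Inv_mul_ar1Filter, Matrix.transpose_one, Matrix.mul_smul,
    Matrix.smul_mul, whitenedProj]

lemma det_scaleMat : (scaleMat x g s n ρ).det = (1 + g n • whitenedProj x s n ρ).det := by
  rw [← ar1Inv_mul_scaleMat, Matrix.det_mul, Matrix.det_mul, Matrix.det_transpose, det_ar1Inv,
    one_mul, mul_one]

lemma scaleMat_inv (hg : 0 ≤ g n) : (scaleMat x g s n ρ)⁻¹ =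
    (ar1Inv n ρ)ᵀ * (1 + g n • whitenedProj x s n ρ)⁻¹ * ar1Inv n ρ := by
  have hdet : IsUnit (1 + g n • whitenedProj x s n ρ).det :=
    isUnit_iff_ne_zero.2 (posDef_one_add_smul (whitenedProj_transpose x s n ρ)
      (dotProduct_whitenedProj_nonneg x s n ρ) hg).det_pos.ne'
  have hA : (ar1Filter n ρ)ᵀ * (ar1Inv n ρ)ᵀ = 1 := by
    rw [← Matrix.transpose_mul, ar1Inv_mul_ar1Filter, Matrix.transpose_one]
  apply Matrix.inv_eq_left_inv
  have h2 : scaleMat x g s n ρ = ar1Filter n ρ * (1 + g n • whitenedProj x s n ρ) *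
      (ar1Filter n ρ)ᵀ := by
    rw [← ar1Inv_mul_scaleMat, Matrix.mul_assoc, Matrix.mul_assoc, mul_eq_one_comm.1 hA,
      Matrix.mul_one, ← Matrix.mul_assoc, ar1Filter_mul_ar1Inv, Matrix.one_mul]
  rw [h2]
  calc _ = (ar1Inv n ρ)ᵀ * ((1 + g n • whitenedProj x s n ρ)⁻¹ *
        (ar1Inv n ρ * ar1Filter n ρ) * (1 + g n • whitenedProj x s n ρ)) *
          (ar1Filter n ρ)ᵀ := by simp only [Matrix.mul_assoc]
    _ = 1 := by
      rw [ar1Inv_mul_ar1Filter, Matrix.mul_one, Matrix.nonsing_inv_mul _ hdet, Matrix.mul_one,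
        mul_eq_one_comm.1 hA]

lemma scaleMat_posSemidef (hg : 0 ≤ g n) : (scaleMat x g s n ρ).PosSemidef := by
  refine Matrix.PosSemidef.add ?_ (Matrix.PosSemidef.smul ?_ hg)
  · simpa [Matrix.conjTranspose_eq_transpose_of_trivial] using
      Matrix.posSemidef_self_mul_conjTranspose (ar1Filter n ρ)
  · change (colProj (designZ x s n ρ)).PosSemidef
    refine Matrix.PosSemidef.of_dotProduct_mulVec_nonneg ?_ fun u => ?_
    · rw [Matrix.IsHermitian, Matrix.conjTranspose_eq_transpose_of_trivial, colProj_transpose]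
    · rw [star_trivial, ← colProj_mulVec_dotProduct]
      exact zero_le_dotProduct_self _

lemma dotProduct_scaleMat_le (hg : 0 ≤ g n) {γ : ℝ} (hγ : 0 < γ) (hρ : |ρ| ≤ 1 - γ)
    (u : Fin n → ℝ) :
    u ⬝ᵥ scaleMat x g s n ρ *ᵥ u ≤ (1 / γ ^ 2 + g n) * (u ⬝ᵥ u) := by
  have h1 : scaleMat x g s n ρ = ar1Filter n ρ * (ar1Filter n ρ)ᵀ +
    g n • colProj (designZ x s n ρ) := rfl
  rw [h1, Matrix.add_mulVec, dotProduct_add, Matrix.smul_mulVec, dotProduct_smul, smul_eq_mul,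
    add_mul, ← colProj_mulVec_dotProduct, ← Matrix.mulVec_mulVec, ← vecNorm_sq u, ← vecNorm_sq]
  have h2 : u ⬝ᵥ ar1Filter n ρ *ᵥ (ar1Filter n ρ)ᵀ *ᵥ u =
      vecNorm ((ar1Filter n ρ)ᵀ *ᵥ u) ^ 2 := by
    rw [vecNorm_sq, mulVec_dotProduct, Matrix.transpose_transpose]
  -- As `A' L' u = u`, the lower bound for `A'` is an upper bound `‖L'u‖ ≤ ‖u‖ / γ`.
  have h3 := le_vecNorm_ar1Inv_transpose hγ.le hρ ((ar1Filter n ρ)ᵀ *ᵥ u)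
  rw [Matrix.mulVec_mulVec, ← Matrix.transpose_mul, ar1Filter_mul_ar1Inv, Matrix.transpose_one,
    Matrix.one_mulVec] at h3
  rw [h2]
  refine add_le_add ?_ (mul_le_mul_of_nonneg_left
    (pow_le_pow_left₀ (vecNorm_nonneg _) (vecNorm_colProj_le _ _) 2) hg)
  rw [div_mul_eq_mul_div, one_mul, le_div_iff₀ (by positivity), mul_comm, ← mul_pow]
  exact pow_le_pow_left₀ (mul_nonneg hγ.le (vecNorm_nonneg _)) h3 2

lemma mulVec_meanVec {b : (s : Finset (Fin p)) → s → ℝ} :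
    ar1Inv n ρ *ᵥ meanVec x b s n ρ = designZ x s n 0 *ᵥ b s := by
  rw [meanVec, Matrix.mulVec_mulVec, ar1Inv_mul_designZ]

end ScaleMat

/-! ### The closed form of the marginal likelihood -/

/-- The substitution `v ↦ v⁻¹` turns the integral into Euler's Gamma integral. -/
lemma integral_inverse_gamma {a r : ℝ} (ha : 0 < a) (hr : 0 < r) :
    ∫ v in Ioi (0 : ℝ), v ^ (-(a + 1)) * Real.exp (-r / v) = Real.Gamma a * r ^ (-a) := by
  have h1 := integral_comp_rpow_Ioi (fun y : ℝ => y ^ (a - 1) * Real.exp (-(r * y)))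
    (p := -1) (by norm_num)
  rw [Real.integral_rpow_mul_exp_neg_mul_Ioi ha hr] at h1
  rw [Real.rpow_neg hr.le, mul_comm, ← Real.inv_rpow hr.le, ← one_div, ← h1]
  refine setIntegral_congr_fun measurableSet_Ioi fun v hv => ?_
  have hv' : (0 : ℝ) < v := hv
  simp only [smul_eq_mul, abs_neg, abs_one, one_mul]
  rw [← mul_assoc, ← Real.rpow_mul hv'.le, ← Real.rpow_add hv', Real.rpow_neg_one]
  congr 2
  · ring
  · rw [div_eq_mul_inv, neg_mul]

section Marginal

variable {p : ℕ} (x : ℕ → Fin p → ℝ) (b : (s : Finset (Fin p)) → s → ℝ) (g : ℕ → ℝ)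
  (s : Finset (Fin p)) (n : ℕ) (ρ : ℝ)

/-- The quadratic form in the exponent of the Gaussian density of the model `s`. -/
def residualForm (y : Fin n → ℝ) : ℝ :=
  (y - meanVec x b s n ρ) ⬝ᵥ (scaleMat x g s n ρ)⁻¹ *ᵥ (y - meanVec x b s n ρ)

lemma residualForm_eq (hg : 0 ≤ g n) (y : Fin n → ℝ) : residualForm x b g s n ρ y =
    (ar1Inv n ρ *ᵥ (y - meanVec x b s n ρ)) ⬝ᵥ (1 + g n • whitenedProj x s n ρ)⁻¹ *ᵥ
      (ar1Inv n ρ *ᵥ (y - meanVec x b s n ρ)) := by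
  rw [residualForm, scaleMat_inv x g s n ρ hg, ← Matrix.mulVec_mulVec, ← Matrix.mulVec_mulVec,
    mulVec_dotProduct]

lemma residualForm_nonneg (hg : 0 ≤ g n) (y : Fin n → ℝ) : 0 ≤ residualForm x b g s n ρ y := by
  have := (scaleMat_posSemidef x g s n ρ hg).inv.dotProduct_mulVec_nonneg (y - meanVec x b s n ρ)
  rwa [star_trivial] at this

lemma one_le_det_scaleMat (hg : 0 ≤ g n) : 1 ≤ (scaleMat x g s n ρ).det := by
  rw [det_scaleMat]
  exact (det_one_add_bounds (whitenedProj_transpose x s n ρ)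
    (dotProduct_whitenedProj_nonneg x s n ρ) hg).1

lemma det_scaleMat_le (hg : 0 ≤ g n) (hρ : |ρ| ≤ 1) :
    (scaleMat x g s n ρ).det ≤ Real.exp (g n * (4 * p)) := by
  rw [det_scaleMat]
  refine (det_one_add_bounds (whitenedProj_transpose x s n ρ)
    (dotProduct_whitenedProj_nonneg x s n ρ) hg).2.trans ?_
  exact Real.exp_le_exp.2 (mul_le_mul_of_nonneg_left (trace_whitenedProj_le x s n hρ) hg)

/-- By conjugacy the integrand is an unnormalised inverse-gamma density with parameters `α + n/2`
and `β + Q/2`; the result is a multivariate t density. -/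
lemma marginal_eq (hg : 0 ≤ g n) {α β : ℝ} (hα : 0 < α) (hβ : 0 < β)
    (y : EuclideanSpace ℝ (Fin n)) :
    marginal x b g α β s n ρ y =
      (√((2 * Real.pi) ^ n * (scaleMat x g s n ρ).det))⁻¹ * (β ^ α / Real.Gamma α) *
        (Real.Gamma (α + n / 2) *
          (β + residualForm x b g s n ρ y.ofLp / 2) ^ (-(α + n / 2 : ℝ))) := by
  have hdet := one_le_det_scaleMat x g s n ρ hg
  have hQ := residualForm_nonneg x b g s n ρ hg y.ofLp
  rw [← integral_inverse_gamma (by positivity) (by positivity), ← integral_const_mul, marginal]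
  refine setIntegral_congr_fun measurableSet_Ioi fun v hv => ?_
  have hv' : (0 : ℝ) < v := hv
  have hinv : (v • scaleMat x g s n ρ)⁻¹ = v⁻¹ • (scaleMat x g s n ρ)⁻¹ := by
    apply Matrix.inv_eq_left_inv
    rw [Matrix.smul_mul, Matrix.mul_smul, smul_smul, inv_mul_cancel₀ hv'.ne', one_smul,
      Matrix.nonsing_inv_mul _ (isUnit_iff_ne_zero.2 (by positivity))]
  have hsq : √((2 * Real.pi) ^ n * (v ^ n * (scaleMat x g s n ρ).det)) =
      √((2 * Real.pi) ^ n * (scaleMat x g s n ρ).det) * v ^ ((n : ℝ) / 2) := by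
    rw [mul_left_comm, mul_comm, Real.sqrt_mul (by positivity)]
    congr 1
    rw [Real.sqrt_eq_rpow, ← Real.rpow_natCast, ← Real.rpow_mul hv'.le]
    congr 1
    ring
  simp only [gaussianDensity, invGammaDensity, Matrix.det_smul, Fintype.card_fin, hinv, hsq,
    Matrix.smul_mulVec, dotProduct_smul, smul_eq_mul]
  change _ * Real.exp (-(v⁻¹ * residualForm x b g s n ρ y.ofLp) / 2) * _ = _
  have hpow : v ^ (-(α + n / 2 + 1 : ℝ)) = (v ^ ((n : ℝ) / 2))⁻¹ * v ^ (-(α + 1)) := by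
    rw [← Real.rpow_neg hv'.le, ← Real.rpow_add hv']
    congr 1
    ring
  have hexp : Real.exp (-(β + residualForm x b g s n ρ y.ofLp / 2) / v) =
      Real.exp (-(v⁻¹ * residualForm x b g s n ρ y.ofLp) / 2) * Real.exp (-β / v) := by
    rw [← Real.exp_add]
    congr 1
    field_simp
    ring
  rw [hpow, hexp, mul_inv]
  ring

lemma marginal_pos (hg : 0 ≤ g n) {α β : ℝ} (hα : 0 < α) (hβ : 0 < β)
    (y : EuclideanSpace ℝ (Fin n)) : 0 < marginal x b g α β s n ρ y := by
  have hdet := one_le_det_scaleMat x g s n ρ hg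
  have hQ := residualForm_nonneg x b g s n ρ hg y.ofLp
  rw [marginal_eq x b g s n ρ hg hα hβ]
  have := Real.Gamma_pos_of_pos hα
  have := Real.Gamma_pos_of_pos (show 0 < α + (n : ℝ) / 2 by positivity)
  positivity

lemma log_marginal (hg : 0 ≤ g n) {α β : ℝ} (hα : 0 < α) (hβ : 0 < β)
    (y : EuclideanSpace ℝ (Fin n)) :
    Real.log (marginal x b g α β s n ρ y) =
      Real.log ((√((2 * Real.pi) ^ n))⁻¹ * (β ^ α / Real.Gamma α) * Real.Gamma (α + n / 2)) -
        1 / 2 * Real.log (scaleMat x g s n ρ).det -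
        (α + n / 2) * Real.log (β + residualForm x b g s n ρ y.ofLp / 2) := by
  have hdet := one_le_det_scaleMat x g s n ρ hg
  have hQ := residualForm_nonneg x b g s n ρ hg y.ofLp
  have h1 := Real.Gamma_pos_of_pos hα
  have h2 := Real.Gamma_pos_of_pos (show 0 < α + (n : ℝ) / 2 by positivity)
  rw [marginal_eq x b g s n ρ hg hα hβ, Real.sqrt_mul (by positivity), mul_inv]
  have h3 : (√((2 * Real.pi) ^ n))⁻¹ * (√(scaleMat x g s n ρ).det)⁻¹ * (β ^ α / Real.Gamma α) *
      (Real.Gamma (α + n / 2) * (β + residualForm x b g s n ρ y.ofLp / 2) ^ (-(α + n / 2 : ℝ))) =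
      ((√((2 * Real.pi) ^ n))⁻¹ * (β ^ α / Real.Gamma α) * Real.Gamma (α + n / 2)) *
      (√(scaleMat x g s n ρ).det)⁻¹ *
      (β + residualForm x b g s n ρ y.ofLp / 2) ^ (-(α + n / 2 : ℝ)) := by ring
  rw [h3, Real.log_mul (by positivity) (by positivity), Real.log_mul (by positivity)
    (by positivity), Real.log_inv, Real.log_sqrt (by positivity), Real.log_rpow (by positivity)]
  ring

/-- The remaining normalising constants depend on `n`, `α`, `β` only and cancel. -/
lemma log_bayesFactor (s₀ : Finset (Fin p)) (ρ₀ : ℝ) (hg : 0 ≤ g n) {α β : ℝ} (hα : 0 < α)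
    (hβ : 0 < β) (y : EuclideanSpace ℝ (Fin n)) :
    Real.log (bayesFactor x b g α β s s₀ ρ₀ n ρ y) =
      1 / 2 * (Real.log (scaleMat x g s₀ n ρ₀).det - Real.log (scaleMat x g s n ρ).det) +
        (α + n / 2) * (Real.log (β + residualForm x b g s₀ n ρ₀ y.ofLp / 2) -
          Real.log (β + residualForm x b g s n ρ y.ofLp / 2)) := by
  rw [bayesFactor, Real.log_div (marginal_pos x b g s n ρ hg hα hβ y).ne'
    (marginal_pos x b g s₀ n ρ₀ hg hα hβ y).ne', log_marginal x b g s n ρ hg hα hβ,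
    log_marginal x b g s₀ n ρ₀ hg hα hβ]
  ring

lemma bayesFactor_pos (s₀ : Finset (Fin p)) (ρ₀ : ℝ) (hg : 0 ≤ g n) {α β : ℝ} (hα : 0 < α)
    (hβ : 0 < β) (y : EuclideanSpace ℝ (Fin n)) : 0 < bayesFactor x b g α β s s₀ ρ₀ n ρ y :=
  div_pos (marginal_pos x b g s n ρ hg hα hβ y) (marginal_pos x b g s₀ n ρ₀ hg hα hβ y)

end Marginal

/-! ### Measurability in the autoregression coefficient -/

section Measurability

lemma measurable_det {ι Θ : Type*} [Fintype ι] [DecidableEq ι] [MeasurableSpace Θ]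
    {f : Θ → Matrix ι ι ℝ} (hf : ∀ i j, Measurable fun θ => f θ i j) :
    Measurable fun θ => (f θ).det := by
  simp only [Matrix.det_apply']
  exact Finset.measurable_sum _ fun σ _ =>
    (Finset.measurable_prod _ fun i _ => hf _ _).const_mul _

/-- Cramer's rule. It also covers singular matrices, since the reciprocal of a zero determinant is
zero. Measurability in `ρ` is needed for the integrability behind every comparison of integrated
Bayes factors. -/
lemma measurable_matrix_inv {ι Θ : Type*} [Fintype ι] [DecidableEq ι] [MeasurableSpace Θ]
    {f : Θ → Matrix ι ι ℝ} (hf : ∀ i j, Measurable fun θ => f θ i j) (i j : ι) :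
    Measurable fun θ => (f θ)⁻¹ i j := by
  simp only [Matrix.inv_def, Ring.inverse_eq_inv', Matrix.smul_apply, smul_eq_mul,
    Matrix.adjugate_apply]
  refine (measurable_det hf).inv.mul (measurable_det fun k l => ?_)
  by_cases h : k = j
  · subst h
    simp
  · simpa [Matrix.updateRow_apply, h] using hf k l

lemma measurable_matrix_mul {ι κ ν Θ : Type*} [Fintype κ] [MeasurableSpace Θ]
    {f : Θ → Matrix ι κ ℝ} {h : Θ → Matrix κ ν ℝ} (hf : ∀ i j, Measurable fun θ => f θ i j)
    (hh : ∀ i j, Measurable fun θ => h θ i j) (i : ι) (j : ν) :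
    Measurable fun θ => (f θ * h θ) i j := by
  simp only [Matrix.mul_apply]
  exact Finset.measurable_sum _ fun k _ => (hf _ _).mul (hh _ _)

variable {p : ℕ} (x : ℕ → Fin p → ℝ) (b : (s : Finset (Fin p)) → s → ℝ) (g : ℕ → ℝ)
  (s : Finset (Fin p)) (n : ℕ)

lemma measurable_designZ (t : Fin n) (j : s) : Measurable fun ρ => designZ x s n ρ t j := by
  simp only [designZ, Matrix.of_apply]
  fun_prop

lemma measurable_scaleMat (i j : Fin n) : Measurable fun ρ => scaleMat x g s n ρ i j := by
  have hZ := measurable_designZ x s n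
  have hL : ∀ i j, Measurable fun ρ => ar1Filter n ρ i j := by
    intro i j
    simp only [ar1Filter, Matrix.of_apply]
    split_ifs <;> fun_prop
  simp only [scaleMat, Matrix.add_apply, Matrix.smul_apply, smul_eq_mul]
  refine (measurable_matrix_mul hL (fun i j => hL j i) i j).add (Measurable.const_mul ?_ _)
  exact measurable_matrix_mul (measurable_matrix_mul hZ (measurable_matrix_inv
    (measurable_matrix_mul (fun i j => hZ j i) hZ))) (fun i j => hZ j i) i j

lemma measurable_residualForm (y : Fin n → ℝ) :
    Measurable fun ρ => residualForm x b g s n ρ y := by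
  have hm : ∀ t, Measurable fun ρ => (y - meanVec x b s n ρ) t := by
    intro t
    simp only [meanVec, Pi.sub_apply, Matrix.mulVec, dotProduct]
    exact measurable_const.sub
      (Finset.measurable_sum _ fun j _ => (measurable_designZ x s n t j).mul_const _)
  simp only [residualForm, dotProduct, Matrix.mulVec]
  exact Finset.measurable_sum _ fun i _ => (hm i).mul (Finset.measurable_sum _ fun j _ =>
    (measurable_matrix_inv (measurable_scaleMat x g s n) i j).mul (hm j))

lemma measurable_bayesFactor (s₀ : Finset (Fin p)) (ρ₀ : ℝ) (hg : 0 ≤ g n) {α β : ℝ} (hα : 0 < α)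
    (hβ : 0 < β) (y : EuclideanSpace ℝ (Fin n)) :
    Measurable fun ρ => bayesFactor x b g α β s s₀ ρ₀ n ρ y := by
  simp only [bayesFactor, marginal_eq x b g s n _ hg hα hβ]
  have h1 := measurable_det (measurable_scaleMat x g s n)
  have h2 := measurable_residualForm x b g s n y.ofLp
  fun_prop

end Measurability

/-! ### Almost sure negligibility of low rank and linear statistics -/

lemma trace_mul_mul_transpose {ι κ : Type*} [Fintype ι] [Fintype κ] (F : Matrix κ ι ℝ)
    (V : Matrix ι ι ℝ) : (F * V * Fᵀ).trace = ∑ i, F i ⬝ᵥ V *ᵥ F i := by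
  simp only [Matrix.trace, Matrix.diag]
  refine Finset.sum_congr rfl fun i _ => ?_
  rw [Matrix.mul_assoc, Matrix.mul_apply']
  congr 1

lemma trace_mul_mul_transpose_le {ι κ : Type*} [Fintype ι] [Fintype κ]
    (F : Matrix κ ι ℝ) {V : Matrix ι ι ℝ} {c : ℝ}
    (hV : ∀ u : ι → ℝ, u ⬝ᵥ V *ᵥ u ≤ c * (u ⬝ᵥ u)) :
    (F * V * Fᵀ).trace ≤ c * (F * Fᵀ).trace := by
  classical
  have h := trace_mul_mul_transpose F 1
  rw [Matrix.mul_one] at h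
  rw [trace_mul_mul_transpose, h, Finset.mul_sum]
  exact Finset.sum_le_sum fun i _ => by simpa using hV (F i)

lemma trace_mul_mul_transpose_nonneg {ι κ : Type*} [Fintype ι] [Fintype κ]
    (F : Matrix κ ι ℝ) {V : Matrix ι ι ℝ} (hV : V.PosSemidef) : 0 ≤ (F * V * Fᵀ).trace := by
  rw [trace_mul_mul_transpose]
  exact Finset.sum_nonneg fun i _ => by simpa using hV.dotProduct_mulVec_nonneg (F i)

section Negligible

variable {Ω : Type*} [MeasurableSpace Ω] {P : Measure Ω}
  {Y : (n : ℕ) → Ω → EuclideanSpace ℝ (Fin n)} {m : (n : ℕ) → Fin n → ℝ}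
  {V : (n : ℕ) → Matrix (Fin n) (Fin n) ℝ} {κ : ℝ}

/-- The expectation of `‖F e‖²` is the trace of `F V F'`, which stays below `κ C`; divided by `n` it
vanishes, and so does the deviation from it by concentration. -/
lemma ae_tendsto_gram
    (hY : ∀ᶠ n in atTop, HasLaw (Y n) (multivariateGaussian (WithLp.toLp 2 (m n)) (V n)) P)
    (hV : ∀ᶠ n in atTop, (V n).PosSemidef)
    (hκ : ∀ᶠ n in atTop, ∀ u : Fin n → ℝ, u ⬝ᵥ V n *ᵥ u ≤ κ * (u ⬝ᵥ u))
    {ι : ℕ → Type*} [∀ n, Fintype (ι n)] {F : (n : ℕ) → Matrix (ι n) (Fin n) ℝ} {K C : ℝ}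
    (hK : ∀ᶠ n in atTop, ∀ u : Fin n → ℝ, (F n *ᵥ u) ⬝ᵥ (F n *ᵥ u) ≤ K * (u ⬝ᵥ u))
    (hC : ∀ᶠ n in atTop, (F n * (F n)ᵀ).trace ≤ C) :
    ∀ᵐ ω ∂P, Tendsto (fun n : ℕ => (F n *ᵥ ((Y n ω).ofLp - m n)) ⬝ᵥ
      (F n *ᵥ ((Y n ω).ofLp - m n)) / n) atTop (nhds 0) := by
  wlog hκ0 : 0 < κ generalizing κ
  · refine this (κ := 1) ?_ one_pos
    filter_upwards [hκ] with n h u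
    exact (h u).trans (mul_le_mul_of_nonneg_right (by linarith) (zero_le_dotProduct_self _))
  have hform : ∀ n (u : Fin n → ℝ), u ⬝ᵥ ((F n)ᵀ * F n) *ᵥ u = (F n *ᵥ u) ⬝ᵥ (F n *ᵥ u) := by
    intro n u
    rw [← Matrix.mulVec_mulVec, mulVec_dotProduct]
  have h := ae_tendsto_quadratic (B := fun n => (F n)ᵀ * F n) (K := K) hY hV hκ
    (Eventually.of_forall fun n => by
      simpa [Matrix.conjTranspose_eq_transpose_of_trivial] using
        Matrix.isHermitian_conjTranspose_mul_self (F n))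
    (hK.mono fun n h u => by
      rw [hform, abs_of_nonneg (zero_le_dotProduct_self _)]
      exact h u)
  have htr : Tendsto (fun n : ℕ => ((F n)ᵀ * F n * V n).trace / n) atTop (nhds 0) := by
    have hlim : Tendsto (fun n : ℕ => κ * C / n) atTop (nhds 0) :=
      tendsto_const_div_atTop_nhds_zero_nat _
    refine tendsto_of_tendsto_of_tendsto_of_le_of_le' tendsto_const_nhds hlim ?_ ?_
    · filter_upwards [hV] with n h1
      rw [Matrix.mul_assoc, Matrix.trace_mul_comm]
      exact div_nonneg (trace_mul_mul_transpose_nonneg _ h1) n.cast_nonneg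
    · filter_upwards [hκ, hC] with n h1 h2
      rw [Matrix.mul_assoc, Matrix.trace_mul_comm]
      refine div_le_div_of_nonneg_right ?_ n.cast_nonneg
      exact (trace_mul_mul_transpose_le _ h1).trans (mul_le_mul_of_nonneg_left h2 hκ0.le)
  filter_upwards [h] with ω hω
  have := hω.add htr
  rw [add_zero] at this
  refine this.congr fun n => ?_
  rw [hform]
  ring

lemma ae_tendsto_vecNorm_gram
    (hY : ∀ᶠ n in atTop, HasLaw (Y n) (multivariateGaussian (WithLp.toLp 2 (m n)) (V n)) P)
    (hV : ∀ᶠ n in atTop, (V n).PosSemidef)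
    (hκ : ∀ᶠ n in atTop, ∀ u : Fin n → ℝ, u ⬝ᵥ V n *ᵥ u ≤ κ * (u ⬝ᵥ u))
    {F : (n : ℕ) → Matrix (Fin n) (Fin n) ℝ} {C : ℝ}
    (hK : ∀ n, ∀ u : Fin n → ℝ, vecNorm (F n *ᵥ u) ≤ vecNorm u)
    (hC : ∀ n, (F n * (F n)ᵀ).trace ≤ C) :
    ∀ᵐ ω ∂P, Tendsto (fun n : ℕ => vecNorm (F n *ᵥ ((Y n ω).ofLp - m n)) / √n) atTop
      (nhds 0) := by
  have h := ae_tendsto_gram (F := F) (K := 1) hY hV hκ (Eventually.of_forall fun n u => by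
    rw [one_mul, ← vecNorm_sq, ← vecNorm_sq]
    exact pow_le_pow_left₀ (vecNorm_nonneg _) (hK n u) 2) (Eventually.of_forall hC)
  filter_upwards [h] with ω hω
  have := (Real.continuous_sqrt.tendsto 0).comp hω
  rw [Real.sqrt_zero] at this
  refine this.congr fun n => ?_
  rw [Function.comp_apply, Real.sqrt_div (zero_le_dotProduct_self _), ← vecNorm_sq,
    Real.sqrt_sq (vecNorm_nonneg _)]

lemma ae_tendsto_linear
    (hY : ∀ᶠ n in atTop, HasLaw (Y n) (multivariateGaussian (WithLp.toLp 2 (m n)) (V n)) P)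
    (hV : ∀ᶠ n in atTop, (V n).PosSemidef)
    (hκ : ∀ᶠ n in atTop, ∀ u : Fin n → ℝ, u ⬝ᵥ V n *ᵥ u ≤ κ * (u ⬝ᵥ u))
    {c : (n : ℕ) → Fin n → ℝ} {C : ℝ} (hc : ∀ n, vecNorm (c n) ≤ C * √n) :
    ∀ᵐ ω ∂P, Tendsto (fun n : ℕ => |c n ⬝ᵥ ((Y n ω).ofLp - m n)| / n) atTop (nhds 0) := by
  -- A linear statistic is the case of a single row: with this scaling `‖F e‖² / n = (c · e / n)²`.
  set F : (n : ℕ) → Matrix Unit (Fin n) ℝ := fun n => Matrix.of fun _ => (√n)⁻¹ • c n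
  have hF : ∀ n (u : Fin n → ℝ), (F n *ᵥ u) ⬝ᵥ (F n *ᵥ u) = ((√n)⁻¹ * (c n ⬝ᵥ u)) ^ 2 := by
    intro n u
    simp only [dotProduct, Finset.univ_unique, Finset.sum_singleton, F, Matrix.mulVec,
      Matrix.of_apply, Pi.smul_apply, smul_eq_mul, sq, Finset.mul_sum, mul_assoc]
  have hcc : ∀ n : ℕ, (√n)⁻¹ * vecNorm (c n) ≤ C ∨ n = 0 := by
    intro n
    rcases Nat.eq_zero_or_pos n with h | h
    · exact Or.inr h
    · left
      have : 0 < √(n : ℝ) := Real.sqrt_pos.2 (by exact_mod_cast h)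
      rw [inv_mul_le_iff₀ this, mul_comm]
      exact hc n
  have h := ae_tendsto_gram (F := F) (K := C ^ 2) (C := C ^ 2) hY hV hκ ?_ ?_
  · filter_upwards [h] with ω hω
    have := (Real.continuous_sqrt.tendsto 0).comp hω
    rw [Real.sqrt_zero] at this
    refine this.congr fun n => ?_
    rw [Function.comp_apply, hF, Real.sqrt_div (sq_nonneg _), Real.sqrt_sq_eq_abs, abs_mul,
      abs_of_nonneg (by positivity)]
    rw [inv_mul_eq_div, div_div, Real.mul_self_sqrt n.cast_nonneg]
  · filter_upwards [eventually_gt_atTop 0] with n hn u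
    rw [hF, ← sq_abs, abs_mul, abs_of_nonneg (by positivity), ← vecNorm_sq, ← mul_pow]
    refine pow_le_pow_left₀ (by positivity) ?_ 2
    refine (mul_le_mul_of_nonneg_left (abs_dotProduct_le _ _) (by positivity)).trans ?_
    rw [← mul_assoc]
    exact mul_le_mul_of_nonneg_right ((hcc n).resolve_right hn.ne') (vecNorm_nonneg _)
  · filter_upwards [eventually_gt_atTop 0] with n hn
    have : (F n * (F n)ᵀ).trace = ((√n)⁻¹ * vecNorm (c n)) ^ 2 := by
      rw [mul_pow, vecNorm_sq, Matrix.trace]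
      simp only [Finset.univ_unique, Finset.sum_singleton, F, Matrix.diag, Matrix.mul_apply,
        Matrix.transpose_apply, Matrix.of_apply, Pi.smul_apply, smul_eq_mul, dotProduct,
        Finset.mul_sum]
      exact Finset.sum_congr rfl fun i _ => by ring
    rw [this]
    exact pow_le_pow_left₀ (mul_nonneg (by positivity) (vecNorm_nonneg _))
      ((hcc n).resolve_right hn.ne') 2

end Negligible

/-! ### Uniform approximation of the residual form -/

section Fluctuation

variable {p : ℕ} (x : ℕ → Fin p → ℝ) (b : (s : Finset (Fin p)) → s → ℝ) (g : ℕ → ℝ)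
  (s : Finset (Fin p)) (n : ℕ)

/-- The whitened difference of the means. -/
def whitenedMeanDiff (m : Fin n → ℝ) (ρ : ℝ) : Fin n → ℝ :=
  ar1Inv n ρ *ᵥ (m - meanVec x b s n ρ)

/-- The deterministic approximation of the residual form for data with mean `m` and covariance
matrix `V`. -/
def limitForm (m : Fin n → ℝ) (V : Matrix (Fin n) (Fin n) ℝ) (ρ : ℝ) : ℝ :=
  whitenedMeanDiff x b s n m ρ ⬝ᵥ
      (1 + g n • whitenedProj x s n ρ)⁻¹ *ᵥ whitenedMeanDiff x b s n m ρ +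
    ((ar1Inv n ρ)ᵀ * ar1Inv n ρ * V).trace

/-- A bound, not depending on `ρ`, of the distance between the residual form and its deterministic
approximation, for the centered data `e`. -/
def fluctuation (m : Fin n → ℝ) (V : Matrix (Fin n) (Fin n) ℝ) (e : Fin n → ℝ) : ℝ :=
  2 * (|(m - designZ x s n 0 *ᵥ b s) ⬝ᵥ e| +
      |((shiftMat n)ᵀ *ᵥ (m - designZ x s n 0 *ᵥ b s)) ⬝ᵥ e| +
      |(shiftMat n *ᵥ m) ⬝ᵥ e| + |((shiftMat n)ᵀ *ᵥ (shiftMat n *ᵥ m)) ⬝ᵥ e|) +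
    (4 * vecNorm m + 2 * vecNorm (designZ x s n 0 *ᵥ b s) + 2 * vecNorm e) *
      (vecNorm (colProj (designZ x s n 0) *ᵥ e) +
        vecNorm ((colProj (designZ x s n 0) * shiftMat n) *ᵥ e)) +
    (|e ⬝ᵥ 1 *ᵥ e - (1 * V).trace| +
      |e ⬝ᵥ (shiftMat n + (shiftMat n)ᵀ) *ᵥ e - ((shiftMat n + (shiftMat n)ᵀ) * V).trace| +
      |e ⬝ᵥ ((shiftMat n)ᵀ * shiftMat n) *ᵥ e - ((shiftMat n)ᵀ * shiftMat n * V).trace|)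

variable {n}

lemma whitenedMeanDiff_eq (m : Fin n → ℝ) (ρ : ℝ) : whitenedMeanDiff x b s n m ρ =
    (m - designZ x s n 0 *ᵥ b s) - ρ • (shiftMat n *ᵥ m) := by
  rw [whitenedMeanDiff, Matrix.mulVec_sub, mulVec_meanVec, ar1Inv_mulVec]
  abel

lemma vecNorm_whitenedMeanDiff_le (m : Fin n → ℝ) {ρ : ℝ} (hρ : |ρ| ≤ 1) :
    vecNorm (whitenedMeanDiff x b s n m ρ) ≤
      2 * vecNorm m + vecNorm (designZ x s n 0 *ᵥ b s) := by
  rw [whitenedMeanDiff, Matrix.mulVec_sub, mulVec_meanVec]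
  exact (vecNorm_sub_le _ _).trans (add_le_add_left (vecNorm_ar1Inv_le hρ m) _)

/-- Both factors are affine in `ρ`, so the product is a quadratic polynomial in `ρ` whose
coefficients are fixed linear statistics of `e`. Bounding the coefficients controls all `|ρ| ≤ 1` at
once. -/
lemma abs_whitenedMeanDiff_dotProduct_le (m e : Fin n → ℝ) {ρ : ℝ} (hρ : |ρ| ≤ 1) :
    |whitenedMeanDiff x b s n m ρ ⬝ᵥ ar1Inv n ρ *ᵥ e| ≤
      |(m - designZ x s n 0 *ᵥ b s) ⬝ᵥ e| +
      |((shiftMat n)ᵀ *ᵥ (m - designZ x s n 0 *ᵥ b s)) ⬝ᵥ e| +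
      |(shiftMat n *ᵥ m) ⬝ᵥ e| + |((shiftMat n)ᵀ *ᵥ (shiftMat n *ᵥ m)) ⬝ᵥ e| := by
  rw [whitenedMeanDiff_eq, ar1Inv_mulVec]
  set a := m - designZ x s n 0 *ᵥ b s
  set c := shiftMat n *ᵥ m
  have h : (a - ρ • c) ⬝ᵥ (e - ρ • (shiftMat n *ᵥ e)) =
      a ⬝ᵥ e - ρ * (((shiftMat n)ᵀ *ᵥ a) ⬝ᵥ e) - ρ * (c ⬝ᵥ e) +
        ρ * (ρ * (((shiftMat n)ᵀ *ᵥ c) ⬝ᵥ e)) := by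
    rw [mulVec_dotProduct _ a, mulVec_dotProduct _ c, Matrix.transpose_transpose]
    simp only [sub_dotProduct, dotProduct_sub, smul_dotProduct, dotProduct_smul, smul_eq_mul]
    ring
  rw [h]
  have hb : ∀ r : ℝ, |ρ * r| ≤ |r| := fun r => by
    rw [abs_mul]
    exact mul_le_of_le_one_left (abs_nonneg r) hρ
  have h1 := abs_add_le (a ⬝ᵥ e - ρ * (((shiftMat n)ᵀ *ᵥ a) ⬝ᵥ e) - ρ * (c ⬝ᵥ e))
    (ρ * (ρ * (((shiftMat n)ᵀ *ᵥ c) ⬝ᵥ e)))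
  have h2 := abs_sub (a ⬝ᵥ e - ρ * (((shiftMat n)ᵀ *ᵥ a) ⬝ᵥ e)) (ρ * (c ⬝ᵥ e))
  have h3 := abs_sub (a ⬝ᵥ e) (ρ * (((shiftMat n)ᵀ *ᵥ a) ⬝ᵥ e))
  have h4 := hb (((shiftMat n)ᵀ *ᵥ a) ⬝ᵥ e)
  have h5 := hb (c ⬝ᵥ e)
  have h6 := (hb (ρ * (((shiftMat n)ᵀ *ᵥ c) ⬝ᵥ e))).trans (hb _)
  linarith

lemma abs_ar1Inv_sq_sub_trace_le (V : Matrix (Fin n) (Fin n) ℝ) (e : Fin n → ℝ) {ρ : ℝ}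
    (hρ : |ρ| ≤ 1) :
    |(ar1Inv n ρ *ᵥ e) ⬝ᵥ (ar1Inv n ρ *ᵥ e) - ((ar1Inv n ρ)ᵀ * ar1Inv n ρ * V).trace| ≤
      |e ⬝ᵥ 1 *ᵥ e - (1 * V).trace| +
      |e ⬝ᵥ (shiftMat n + (shiftMat n)ᵀ) *ᵥ e - ((shiftMat n + (shiftMat n)ᵀ) * V).trace| +
      |e ⬝ᵥ ((shiftMat n)ᵀ * shiftMat n) *ᵥ e - ((shiftMat n)ᵀ * shiftMat n * V).trace| := by
  have hM : (ar1Inv n ρ)ᵀ * ar1Inv n ρ = 1 - ρ • (shiftMat n + (shiftMat n)ᵀ) +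
      ρ • ρ • ((shiftMat n)ᵀ * shiftMat n) := by
    rw [ar1Inv, Matrix.transpose_sub, Matrix.transpose_one, Matrix.transpose_smul, Matrix.sub_mul,
      Matrix.mul_sub, Matrix.mul_sub, Matrix.one_mul, Matrix.mul_one, Matrix.one_mul,
      Matrix.smul_mul, Matrix.mul_smul, smul_add]
    abel
  have h : (ar1Inv n ρ *ᵥ e) ⬝ᵥ (ar1Inv n ρ *ᵥ e) - ((ar1Inv n ρ)ᵀ * ar1Inv n ρ * V).trace =
      (e ⬝ᵥ 1 *ᵥ e - (1 * V).trace) -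
      ρ * (e ⬝ᵥ (shiftMat n + (shiftMat n)ᵀ) *ᵥ e - ((shiftMat n + (shiftMat n)ᵀ) * V).trace) +
      ρ * (ρ * (e ⬝ᵥ ((shiftMat n)ᵀ * shiftMat n) *ᵥ e -
        ((shiftMat n)ᵀ * shiftMat n * V).trace)) := by
    rw [mulVec_dotProduct, Matrix.mulVec_mulVec, hM]
    simp only [Matrix.add_mulVec, Matrix.sub_mulVec, Matrix.smul_mulVec, dotProduct_add,
      dotProduct_sub, dotProduct_smul, smul_eq_mul, Matrix.add_mul, Matrix.sub_mul,
      Matrix.smul_mul, Matrix.trace_add, Matrix.trace_sub, Matrix.trace_smul]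
    ring
  rw [h]
  have hb : ∀ r : ℝ, |ρ * r| ≤ |r| := fun r => by
    rw [abs_mul]
    exact mul_le_of_le_one_left (abs_nonneg r) hρ
  refine (abs_add_le _ _).trans (add_le_add ((abs_sub _ _).trans ?_) ((hb _).trans (hb _)))
  exact add_le_add_right (hb _) _

lemma abs_residualForm_sub_limitForm_le (hg : 0 ≤ g n)
    (hX : ((designZ x s n 0)ᵀ * designZ x s n 0).det ≠ 0) (m : Fin n → ℝ)
    (V : Matrix (Fin n) (Fin n) ℝ) (y : Fin n → ℝ) {ρ : ℝ} (hρ : |ρ| ≤ 1) :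
    |residualForm x b g s n ρ y - limitForm x b g s n m V ρ| ≤
      fluctuation x b s n m V (y - m) := by
  set e := y - m with he
  set d := whitenedMeanDiff x b s n m ρ with hd
  set a := ar1Inv n ρ *ᵥ e with ha
  obtain ⟨hDT, -, -, hD⟩ := precision_bounds (whitenedProj_transpose x s n ρ)
    (dotProduct_whitenedProj_nonneg x s n ρ) (dotProduct_whitenedProj_le x s n hρ)
    (whitenedProj_mulVec_sq_le x s n hρ) hg (whitenedProj_mul_colProj x s n ρ hX)
  set D := (1 + g n • whitenedProj x s n ρ)⁻¹ with hDdef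
  set R := colProj (designZ x s n 0) with hR
  have hu : ar1Inv n ρ *ᵥ (y - meanVec x b s n ρ) = d + a := by
    rw [hd, ha, whitenedMeanDiff, ← Matrix.mulVec_add, he]
    congr 1
    abel
  have hsym : a ⬝ᵥ D *ᵥ d = d ⬝ᵥ D *ᵥ a := by
    rw [dotProduct_comm, mulVec_dotProduct, hDT]
  -- The residual form is `(d + a) · D (d + a)` with `d` deterministic and `a = A e`. In the terms
  -- containing `a` the matrix `D` is replaced by the identity; the corrections involve only `R a`,
  -- the component in a space of dimension at most `p`.
  have hexp : residualForm x b g s n ρ y - limitForm x b g s n m V ρ =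
      2 * (d ⬝ᵥ a) - 2 * (d ⬝ᵥ a - d ⬝ᵥ D *ᵥ a) - (a ⬝ᵥ a - a ⬝ᵥ D *ᵥ a) +
        (a ⬝ᵥ a - ((ar1Inv n ρ)ᵀ * ar1Inv n ρ * V).trace) := by
    rw [residualForm_eq x b g s n ρ hg, hu, limitForm, ← hd, ← hDdef, Matrix.mulVec_add,
      dotProduct_add, add_dotProduct, add_dotProduct, hsym]
    ring
  have hRa : vecNorm (R *ᵥ a) ≤ vecNorm (R *ᵥ e) + vecNorm ((R * shiftMat n) *ᵥ e) := by
    rw [ha, ar1Inv_mulVec, Matrix.mulVec_sub, Matrix.mulVec_smul, Matrix.mulVec_mulVec]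
    refine (vecNorm_sub_le _ _).trans (add_le_add_right ?_ _)
    rw [vecNorm_smul]
    exact mul_le_of_le_one_left (vecNorm_nonneg _) hρ
  have hda := abs_whitenedMeanDiff_dotProduct_le x b s m e hρ
  have haa := abs_ar1Inv_sq_sub_trace_le V e hρ
  rw [← ha] at haa hda
  rw [← hd] at hda
  have h1 := hD d a
  have h2 := hD a a
  have hdn := vecNorm_whitenedMeanDiff_le x b s m hρ
  rw [← hd] at hdn
  have han := vecNorm_ar1Inv_le hρ e
  rw [← ha] at han
  have h3 : (2 * vecNorm d + vecNorm a) * vecNorm (R *ᵥ a) ≤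
      (4 * vecNorm m + 2 * vecNorm (designZ x s n 0 *ᵥ b s) + 2 * vecNorm e) *
      (vecNorm (R *ᵥ e) + vecNorm ((R * shiftMat n) *ᵥ e)) := by
    have := vecNorm_nonneg m
    have := vecNorm_nonneg e
    have := vecNorm_nonneg (designZ x s n 0 *ᵥ b s)
    exact mul_le_mul (by linarith) hRa (vecNorm_nonneg _) (by positivity)
  rw [hexp, fluctuation, ← hR]
  rw [abs_le] at *
  constructor <;> linarith [h1.1, h1.2, h2.1, h2.2, hda.1, hda.2, haa.1, haa.2]

end Fluctuation

/-! ### Almost sure negligibility of the fluctuation bound -/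

section Asymptotics

variable {Ω : Type*} [MeasurableSpace Ω] {P : Measure Ω}
  {Y : (n : ℕ) → Ω → EuclideanSpace ℝ (Fin n)} {m : (n : ℕ) → Fin n → ℝ}
  {V : (n : ℕ) → Matrix (Fin n) (Fin n) ℝ} {κ : ℝ}

lemma trace_le_of_dotProduct_le {n : ℕ} {V : Matrix (Fin n) (Fin n) ℝ} {κ : ℝ}
    (hκ : ∀ u : Fin n → ℝ, u ⬝ᵥ V *ᵥ u ≤ κ * (u ⬝ᵥ u)) : V.trace ≤ κ * n := by
  have : ∀ i, V i i ≤ κ := fun i => by simpa using hκ (Pi.single i 1)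
  calc V.trace ≤ ∑ _i : Fin n, κ := Finset.sum_le_sum fun i _ => this i
    _ = κ * n := by simp [mul_comm]

lemma ae_tendsto_abs_quadratic
    (hY : ∀ᶠ n in atTop, HasLaw (Y n) (multivariateGaussian (WithLp.toLp 2 (m n)) (V n)) P)
    (hV : ∀ᶠ n in atTop, (V n).PosSemidef)
    (hκ : ∀ᶠ n in atTop, ∀ u : Fin n → ℝ, u ⬝ᵥ V n *ᵥ u ≤ κ * (u ⬝ᵥ u))
    {B : (n : ℕ) → Matrix (Fin n) (Fin n) ℝ} (hB : ∀ n, (B n)ᵀ = B n) {K : ℝ}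
    (hK : ∀ n, ∀ u : Fin n → ℝ, vecNorm (B n *ᵥ u) ≤ K * vecNorm u) :
    ∀ᵐ ω ∂P, Tendsto (fun n : ℕ => |((Y n ω).ofLp - m n) ⬝ᵥ B n *ᵥ ((Y n ω).ofLp - m n) -
      (B n * V n).trace| / n) atTop (nhds 0) := by
  have h := ae_tendsto_quadratic (B := B) (K := K) hY hV hκ
    (Eventually.of_forall fun n => by
      rw [Matrix.IsHermitian, Matrix.conjTranspose_eq_transpose_of_trivial, hB])
    (Eventually.of_forall fun n u => by
      refine (abs_dotProduct_le _ _).trans ?_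
      rw [← vecNorm_sq]
      nlinarith [mul_le_mul_of_nonneg_left (hK n u) (vecNorm_nonneg u)])
  filter_upwards [h] with ω hω
  have := hω.abs
  rw [abs_zero] at this
  refine this.congr fun n => ?_
  rw [abs_div, Nat.abs_cast]

variable {p : ℕ} (x : ℕ → Fin p → ℝ) (b : (s : Finset (Fin p)) → s → ℝ) (s : Finset (Fin p))

lemma ae_tendsto_fluctuation
    (hY : ∀ᶠ n in atTop, HasLaw (Y n) (multivariateGaussian (WithLp.toLp 2 (m n)) (V n)) P)
    (hV : ∀ᶠ n in atTop, (V n).PosSemidef)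
    (hκ : ∀ᶠ n in atTop, ∀ u : Fin n → ℝ, u ⬝ᵥ V n *ᵥ u ≤ κ * (u ⬝ᵥ u)) {C : ℝ}
    (hm : ∀ n, vecNorm (m n) ≤ C * √n)
    (hX : ∀ n, vecNorm (designZ x s n 0 *ᵥ b s) ≤ C * √n) :
    ∀ᵐ ω ∂P, Tendsto (fun n : ℕ =>
      fluctuation x b s n (m n) (V n) ((Y n ω).ofLp - m n) / n) atTop (nhds 0) := by
  have ha : ∀ n, vecNorm (m n - designZ x s n 0 *ᵥ b s) ≤ (C + C) * √n := fun n => by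
    rw [add_mul]
    exact (vecNorm_sub_le _ _).trans (add_le_add (hm n) (hX n))
  have l1 := ae_tendsto_linear hY hV hκ ha
  have l2 := ae_tendsto_linear hY hV hκ fun n =>
    (vecNorm_shiftMat_transpose_mulVec_le _).trans (ha n)
  have l3 := ae_tendsto_linear hY hV hκ fun n => (vecNorm_shiftMat_mulVec_le _).trans (hm n)
  have l4 := ae_tendsto_linear hY hV hκ fun n =>
    (vecNorm_shiftMat_transpose_mulVec_le _).trans ((vecNorm_shiftMat_mulVec_le _).trans (hm n))
  have htr : ∀ n, (colProj (designZ x s n 0)).trace ≤ p := fun n => by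
    refine (trace_colProj_le _).trans ?_
    rw [Fintype.card_coe]
    exact_mod_cast (Finset.card_le_univ s).trans (by simp)
  have c1 := ae_tendsto_vecNorm_gram (F := fun n => colProj (designZ x s n 0)) (C := p) hY hV hκ
    (fun n u => vecNorm_colProj_le _ u) (fun n => by
      rw [colProj_transpose, colProj_mul_self]
      exact htr n)
  have c2 := ae_tendsto_vecNorm_gram (F := fun n => colProj (designZ x s n 0) * shiftMat n)
    (C := p) hY hV hκ (fun n u => by
      rw [← Matrix.mulVec_mulVec]
      exact (vecNorm_colProj_le _ _).trans (vecNorm_shiftMat_mulVec_le _)) (fun n => by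
      -- Cyclicity of the trace puts the contraction `N'` to the left of the projection, where it
      -- can only decrease the trace.
      have h : ((colProj (designZ x s n 0) * shiftMat n) *
          (colProj (designZ x s n 0) * shiftMat n)ᵀ).trace =
          (((shiftMat n)ᵀ * colProj (designZ x s n 0)) *
          ((shiftMat n)ᵀ * colProj (designZ x s n 0))ᵀ).trace := by
        rw [Matrix.trace_mul_comm, Matrix.transpose_mul, Matrix.transpose_mul, colProj_transpose,
          Matrix.transpose_transpose]
      rw [h]
      refine (trace_mul_transpose_le (c := 1) _ _ fun u => ?_).trans ?_
      · rw [one_mul, ← vecNorm_sq, ← vecNorm_sq]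
        exact pow_le_pow_left₀ (vecNorm_nonneg _) (vecNorm_shiftMat_transpose_mulVec_le u) 2
      · rw [one_mul, colProj_transpose, colProj_mul_self]
        exact htr n)
  have q1 := ae_tendsto_abs_quadratic (B := fun n => 1) (K := 1) hY hV hκ
    (fun n => Matrix.transpose_one) (fun n u => by simp)
  have q2 := ae_tendsto_abs_quadratic (B := fun n => shiftMat n + (shiftMat n)ᵀ) (K := 2) hY hV hκ
    (fun n => by rw [Matrix.transpose_add, Matrix.transpose_transpose, add_comm]) (fun n u => by
      rw [Matrix.add_mulVec, two_mul]
      exact (vecNorm_add_le _ _).trans (add_le_add (vecNorm_shiftMat_mulVec_le _)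
        (vecNorm_shiftMat_transpose_mulVec_le _)))
  have q3 := ae_tendsto_abs_quadratic (B := fun n => (shiftMat n)ᵀ * shiftMat n) (K := 1) hY hV hκ
    (fun n => by rw [Matrix.transpose_mul, Matrix.transpose_transpose]) (fun n u => by
      rw [← Matrix.mulVec_mulVec, one_mul]
      exact (vecNorm_shiftMat_transpose_mulVec_le _).trans (vecNorm_shiftMat_mulVec_le _))
  filter_upwards [l1, l2, l3, l4, c1, c2, q1, q2, q3] with ω l1 l2 l3 l4 c1 c2 q1 q2 q3
  have hC0 : 0 ≤ C := by
    have := (vecNorm_nonneg _).trans (hm 1)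
    simpa using this
  have hκ0 : 0 ≤ κ := by
    obtain ⟨n, h1, h2, hn⟩ := (hV.and (hκ.and (eventually_gt_atTop 0))).exists
    have h3 := h1.dotProduct_mulVec_nonneg (Pi.single ⟨0, hn⟩ 1)
    have h4 := h2 (Pi.single ⟨0, hn⟩ 1)
    rw [star_trivial] at h3
    simpa using h3.trans h4
  -- Concentration of `‖e‖²` around the trace of `V` gives `‖e‖² ≤ (κ + 1) n`, and `κ + 1 ≤ (κ +
  -- 1)²`. The first factor of the cross term is thus `O(√n)`, while the projected errors are
  -- `o(√n)`.
  have he : ∀ᶠ n : ℕ in atTop, vecNorm ((Y n ω).ofLp - m n) / √n ≤ κ + 1 := by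
    filter_upwards [q1.eventually (gt_mem_nhds one_pos), hκ, eventually_gt_atTop 0] with n h1 h2 hn
    have hn' : (0 : ℝ) < n := by exact_mod_cast hn
    have h3 := trace_le_of_dotProduct_le h2
    rw [div_lt_iff₀ hn', Matrix.one_mulVec, Matrix.one_mul, ← vecNorm_sq] at h1
    have h4 := (abs_lt.1 h1).2
    rw [div_le_iff₀ (Real.sqrt_pos.2 hn')]
    refine (sq_le_sq₀ (vecNorm_nonneg _) (by positivity)).1 ?_
    rw [mul_pow, Real.sq_sqrt hn'.le]
    nlinarith
  have hcross : Tendsto (fun n : ℕ => (4 * vecNorm (m n) +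
      2 * vecNorm (designZ x s n 0 *ᵥ b s) + 2 * vecNorm ((Y n ω).ofLp - m n)) *
      (vecNorm (colProj (designZ x s n 0) *ᵥ ((Y n ω).ofLp - m n)) +
        vecNorm ((colProj (designZ x s n 0) * shiftMat n) *ᵥ ((Y n ω).ofLp - m n))) / n)
      atTop (nhds 0) := by
    have hlim := (c1.add c2).const_mul (6 * C + 2 * (κ + 1))
    rw [add_zero, mul_zero] at hlim
    refine tendsto_of_tendsto_of_tendsto_of_le_of_le' tendsto_const_nhds hlim ?_ ?_
    · refine Eventually.of_forall fun n => div_nonneg (mul_nonneg ?_ ?_) n.cast_nonneg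
      · have := vecNorm_nonneg (m n)
        have := vecNorm_nonneg (designZ x s n 0 *ᵥ b s)
        have := vecNorm_nonneg ((Y n ω).ofLp - m n)
        positivity
      · exact add_nonneg (vecNorm_nonneg _) (vecNorm_nonneg _)
    · filter_upwards [he, eventually_gt_atTop 0] with n h1 hn
      have hn' : (0 : ℝ) < √n := Real.sqrt_pos.2 (by exact_mod_cast hn)
      rw [div_le_iff₀ hn'] at h1
      have h2 := hm n
      have h3 := hX n
      rw [← add_div, mul_div_assoc', div_le_div_iff₀ (by positivity) hn']
      have h4 := Real.mul_self_sqrt (n.cast_nonneg (α := ℝ))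
      have h5 : 0 ≤ vecNorm (colProj (designZ x s n 0) *ᵥ ((Y n ω).ofLp - m n)) +
        vecNorm ((colProj (designZ x s n 0) * shiftMat n) *ᵥ ((Y n ω).ofLp - m n)) :=
        add_nonneg (vecNorm_nonneg _) (vecNorm_nonneg _)
      set r := vecNorm (colProj (designZ x s n 0) *ᵥ ((Y n ω).ofLp - m n)) +
        vecNorm ((colProj (designZ x s n 0) * shiftMat n) *ᵥ ((Y n ω).ofLp - m n))
      calc _ ≤ ((6 * C + 2 * (κ + 1)) * √n) * r * √n := by
            refine mul_le_mul_of_nonneg_right (mul_le_mul_of_nonneg_right ?_ h5) hn'.le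
            linarith
        _ = (6 * C + 2 * (κ + 1)) * r * (√n * √n) := by ring
        _ = _ := by rw [h4]
  have := ((((l1.add l2).add l3).add l4).const_mul 2).add (hcross.add ((q1.add q2).add q3))
  simp only [add_zero, mul_zero] at this
  refine this.congr fun n => ?_
  rw [fluctuation]
  ring

end Asymptotics

/-! ### Bounds for the deterministic approximation -/

section LimitForm

variable {p : ℕ} (x : ℕ → Fin p → ℝ) (b : (s : Finset (Fin p)) → s → ℝ) (g : ℕ → ℝ)
  (s : Finset (Fin p)) {n : ℕ}

lemma ar1Inv_mul_ar1Filter_diag (ρ ρ₀ : ℝ) (i : Fin n) :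
    (ar1Inv n ρ * ar1Filter n ρ₀) i i = 1 := by
  rw [ar1Inv, Matrix.sub_mul, Matrix.one_mul, Matrix.smul_mul, Matrix.sub_apply,
    Matrix.smul_apply, Matrix.mul_apply, Finset.sum_eq_zero]
  · simp [ar1Filter]
  · intro j _
    simp only [shiftMat, ar1Filter, Matrix.of_apply, Fin.le_def]
    by_cases h : (j : ℕ) + 1 = i
    · rw [if_neg (show ¬(i : ℕ) ≤ j by omega), mul_zero]
    · rw [if_neg h, zero_mul]

lemma trace_ar1Inv_scaleMat (ρ : ℝ) (H : Matrix (Fin n) (Fin n) ℝ) :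
    ((ar1Inv n ρ)ᵀ * ar1Inv n ρ * H).trace = (ar1Inv n ρ * H * (ar1Inv n ρ)ᵀ).trace := by
  rw [Matrix.mul_assoc, Matrix.trace_mul_comm]

/-- A wrong `ρ` cannot reduce the noise: `A(ρ) L(ρ₀)` has unit diagonal, so each of its rows has
norm at least one, and the prior part of the covariance only adds to the trace. -/
lemma le_trace_ar1Inv_scaleMat (hg : 0 ≤ g n) (ρ ρ₀ : ℝ) :
    (n : ℝ) ≤ ((ar1Inv n ρ)ᵀ * ar1Inv n ρ * scaleMat x g s n ρ₀).trace := by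
  have h1 : scaleMat x g s n ρ₀ = ar1Filter n ρ₀ * (ar1Filter n ρ₀)ᵀ +
    g n • colProj (designZ x s n ρ₀) := rfl
  have h2 : 0 ≤ (ar1Inv n ρ * colProj (designZ x s n ρ₀) * (ar1Inv n ρ)ᵀ).trace := by
    rw [trace_mul_mul_transpose]
    refine Finset.sum_nonneg fun i _ => ?_
    rw [← colProj_mulVec_dotProduct]
    exact zero_le_dotProduct_self _
  have h3 : (n : ℝ) ≤ (ar1Inv n ρ * (ar1Filter n ρ₀ * (ar1Filter n ρ₀)ᵀ) *
      (ar1Inv n ρ)ᵀ).trace := by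
    have : ar1Inv n ρ * (ar1Filter n ρ₀ * (ar1Filter n ρ₀)ᵀ) * (ar1Inv n ρ)ᵀ =
        (ar1Inv n ρ * ar1Filter n ρ₀) * 1 * (ar1Inv n ρ * ar1Filter n ρ₀)ᵀ := by
      rw [Matrix.mul_one, Matrix.transpose_mul]
      simp only [Matrix.mul_assoc]
    rw [this, trace_mul_mul_transpose]
    calc (n : ℝ) = ∑ _i : Fin n, (1 : ℝ) := by simp
      _ ≤ _ := Finset.sum_le_sum fun i _ => by
        rw [Matrix.one_mulVec]
        have := Finset.single_le_sum (f := fun j => (ar1Inv n ρ * ar1Filter n ρ₀) i j *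
          (ar1Inv n ρ * ar1Filter n ρ₀) i j) (fun j _ => mul_self_nonneg _) (Finset.mem_univ i)
        simp only [ar1Inv_mul_ar1Filter_diag, mul_one] at this
        exact this
  rw [trace_ar1Inv_scaleMat, h1, Matrix.mul_add, Matrix.add_mul, Matrix.trace_add, Matrix.mul_smul,
    Matrix.smul_mul, Matrix.trace_smul, smul_eq_mul]
  have := mul_nonneg hg h2
  linarith

lemma trace_ar1Inv_le {ρ : ℝ} (hρ : |ρ| ≤ 1) {V : Matrix (Fin n) (Fin n) ℝ} {κ : ℝ} (hκ0 : 0 ≤ κ)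
    (hκ : ∀ u : Fin n → ℝ, u ⬝ᵥ V *ᵥ u ≤ κ * (u ⬝ᵥ u)) :
    ((ar1Inv n ρ)ᵀ * ar1Inv n ρ * V).trace ≤ 4 * κ * n := by
  rw [trace_ar1Inv_scaleMat]
  refine (trace_mul_mul_transpose_le _ hκ).trans ?_
  have h := trace_mul_transpose_le (c := 4) (ar1Inv n ρ) (1 : Matrix (Fin n) (Fin n) ℝ)
    fun u => by
      rw [← vecNorm_sq, ← vecNorm_sq]
      calc _ ≤ (2 * vecNorm u) ^ 2 :=
            pow_le_pow_left₀ (vecNorm_nonneg _) (vecNorm_ar1Inv_le hρ u) 2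
        _ = _ := by ring
  rw [Matrix.mul_one, Matrix.transpose_one, Matrix.mul_one, Matrix.trace_one, Fintype.card_fin] at h
  nlinarith

lemma limitForm_true (ρ₀ v₀ : ℝ) :
    limitForm x b g s n (meanVec x b s n ρ₀) (v₀ • scaleMat x g s n ρ₀) ρ₀ =
      v₀ * (n + g n * (whitenedProj x s n ρ₀).trace) := by
  rw [limitForm, whitenedMeanDiff, sub_self, Matrix.mulVec_zero, zero_dotProduct, zero_add,
    Matrix.mul_smul, Matrix.trace_smul, trace_ar1Inv_scaleMat, ar1Inv_mul_scaleMat,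
    Matrix.trace_add, Matrix.trace_one, Matrix.trace_smul, smul_eq_mul, smul_eq_mul,
    Fintype.card_fin]

lemma dotProduct_precision_bounds (hg : 0 ≤ g n) {ρ : ℝ} (hρ : |ρ| ≤ 1)
    (u : Fin n → ℝ) :
    u ⬝ᵥ u ≤ (1 + 4 * g n) * (u ⬝ᵥ (1 + g n • whitenedProj x s n ρ)⁻¹ *ᵥ u) ∧
    u ⬝ᵥ (1 + g n • whitenedProj x s n ρ)⁻¹ *ᵥ u ≤ u ⬝ᵥ u := by
  obtain ⟨-, h1, h2, -⟩ := precision_bounds (whitenedProj_transpose x s n ρ)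
    (dotProduct_whitenedProj_nonneg x s n ρ) (dotProduct_whitenedProj_le x s n hρ)
    (whitenedProj_mulVec_sq_le x s n hρ) hg (Matrix.mul_one _)
  exact ⟨h1 u, h2 u⟩

lemma meanVec_le {γ ρ : ℝ} (hγ : 0 < γ) (hρ : |ρ| ≤ 1 - γ) :
    vecNorm (meanVec x b s n ρ) ≤ γ⁻¹ * vecNorm (designZ x s n 0 *ᵥ b s) := by
  rw [← mulVec_meanVec x s n ρ, ← div_eq_inv_mul, le_div_iff₀ hγ, mul_comm]
  exact le_vecNorm_ar1Inv hγ.le hρ _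

/-- Resolvent identity: `A(ρ) μ(ρ) = A(ρ') μ(ρ') = X_s b` implies `A(ρ) (μ(ρ) - μ(ρ')) = (ρ - ρ') N
μ(ρ')`. The means divided by `√n` are therefore Lipschitz in `ρ` with a constant free of `n`. -/
lemma vecNorm_meanVec_sub_le {γ ρ ρ' : ℝ} (hγ : 0 < γ) (hρ : |ρ| ≤ 1 - γ) (hρ' : |ρ'| ≤ 1 - γ) :
    vecNorm (meanVec x b s n ρ - meanVec x b s n ρ') ≤
      γ⁻¹ * (|ρ' - ρ| * (γ⁻¹ * vecNorm (designZ x s n 0 *ᵥ b s))) := by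
  have h1 : ar1Inv n ρ *ᵥ (meanVec x b s n ρ - meanVec x b s n ρ') =
      (ρ - ρ') • (shiftMat n *ᵥ meanVec x b s n ρ') := by
    rw [Matrix.mulVec_sub, mulVec_meanVec, ← mulVec_meanVec x s n ρ', ar1Inv_mulVec, ar1Inv_mulVec,
      sub_smul]
    abel
  have h2 := le_vecNorm_ar1Inv hγ.le hρ (meanVec x b s n ρ - meanVec x b s n ρ')
  rw [h1, vecNorm_smul, mul_comm] at h2
  rw [inv_mul_eq_div, le_div_iff₀ hγ, abs_sub_comm]
  refine h2.trans (mul_le_mul_of_nonneg_left ?_ (abs_nonneg _))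
  exact (vecNorm_shiftMat_mulVec_le _).trans (meanVec_le x b s hγ hρ')

lemma exists_vecNorm_design_le {K : Set (Fin p → ℝ)} (hK : IsCompact K) (hx : ∀ t, x t ∈ K) :
    ∃ C, 0 ≤ C ∧ ∀ n : ℕ, vecNorm (designZ x s n 0 *ᵥ b s) ≤ C * √n := by
  obtain ⟨R, hR⟩ := hK.isBounded.exists_norm_le
  refine ⟨∑ j, R * |b s j|, Finset.sum_nonneg fun j _ =>
    mul_nonneg ((norm_nonneg _).trans (hR _ (hx 0))) (abs_nonneg _), fun n => ?_⟩
  have hR0 : 0 ≤ R := (norm_nonneg _).trans (hR _ (hx 0))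
  have hC : 0 ≤ ∑ j, R * |b s j| :=
    Finset.sum_nonneg fun j _ => mul_nonneg hR0 (abs_nonneg _)
  have h : ∀ t : Fin n, |(designZ x s n 0 *ᵥ b s) t| ≤ ∑ j, R * |b s j| := by
    intro t
    rw [designZ_zero, Matrix.mulVec, dotProduct]
    refine (Finset.abs_sum_le_sum_abs _ _).trans (Finset.sum_le_sum fun j _ => ?_)
    rw [abs_mul]
    exact mul_le_mul_of_nonneg_right ((norm_le_pi_norm (x t) j).trans (hR _ (hx t)))
      (abs_nonneg _)
  refine (sq_le_sq₀ (vecNorm_nonneg _) (by positivity)).1 ?_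
  rw [vecNorm_sq, mul_pow, Real.sq_sqrt n.cast_nonneg, dotProduct]
  calc _ ≤ ∑ _t : Fin n, (∑ j, R * |b s j|) ^ 2 := Finset.sum_le_sum fun t _ => by
        rw [← sq, ← sq_abs]
        exact pow_le_pow_left₀ (abs_nonneg _) (h t) 2
    _ = _ := by simp [mul_comm]

end LimitForm

/-! ### Uniform separation of the means -/

lemma abs_le_of_mem_Icc {γ ρ : ℝ} (h : ρ ∈ Icc (-1 + γ) (1 - γ)) : |ρ| ≤ 1 - γ :=
  abs_le.2 ⟨by linarith [h.1], h.2⟩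

/-- Equi-Lipschitz continuity extends the separation at one `ρ` to a neighbourhood, with half the
constant and the same threshold for `n`; compactness of the interval leaves finitely many
neighbourhoods. -/
lemma exists_uniform_separation {p : ℕ} (x : ℕ → Fin p → ℝ)
    (b : (s : Finset (Fin p)) → s → ℝ) (s : Finset (Fin p)) {γ C : ℝ} (hγ : 0 < γ)
    {m : (n : ℕ) → Fin n → ℝ} (hC0 : 0 ≤ C)
    (hC : ∀ n : ℕ, vecNorm (designZ x s n 0 *ᵥ b s) ≤ C * √n)
    (hsep : ∀ ρ ∈ Icc (-1 + γ) (1 - γ), 0 < liminf (fun n : ℕ => ((1 / (n : ℝ) *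
      ∑ t, (meanVec x b s n ρ t - m n t) ^ 2 : ℝ) : EReal)) atTop) :
    ∃ η > 0, ∀ᶠ n : ℕ in atTop, ∀ ρ ∈ Icc (-1 + γ) (1 - γ),
      η * √n ≤ vecNorm (m n - meanVec x b s n ρ) := by
  have key := (isCompact_Icc (a := -1 + γ) (b := 1 - γ)).induction_on
    (p := fun S => ∃ η > 0, ∀ᶠ n : ℕ in atTop, ∀ ρ ∈ S, ρ ∈ Icc (-1 + γ) (1 - γ) →
      η * √n ≤ vecNorm (m n - meanVec x b s n ρ)) ?_ ?_ ?_ ?_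
  · obtain ⟨η, hη, h⟩ := key
    exact ⟨η, hη, h.mono fun n hn ρ hρ => hn ρ hρ hρ⟩
  · exact ⟨1, one_pos, by simp⟩
  · rintro S S' hS ⟨η, hη, h⟩
    exact ⟨η, hη, h.mono fun n hn ρ hρ => hn ρ (hS hρ)⟩
  · rintro S S' ⟨η, hη, h⟩ ⟨η', hη', h'⟩
    refine ⟨min η η', lt_min hη hη', (h.and h').mono fun n hn ρ hρ hI => ?_⟩
    rcases hρ with hρ | hρ
    · exact (mul_le_mul_of_nonneg_right (min_le_left _ _) (Real.sqrt_nonneg _)).trans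
        (hn.1 ρ hρ hI)
    · exact (mul_le_mul_of_nonneg_right (min_le_right _ _) (Real.sqrt_nonneg _)).trans
        (hn.2 ρ hρ hI)
  · intro ρ hρ
    obtain ⟨q, hq0, hq⟩ := EReal.lt_iff_exists_real_btwn.1 (hsep ρ hρ)
    have hq0' : 0 < q := by exact_mod_cast hq0
    have hev := eventually_lt_of_lt_liminf hq
    -- On a ball of this radius the scaled mean moves by at most `√q / 2`; `C + 1` replaces `C` to
    -- keep the divisor positive.
    set δ := γ ^ 2 * √q / (2 * (C + 1)) with hδ
    have hsq : 0 < √q := Real.sqrt_pos.2 hq0'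
    have hδ0 : 0 < δ := by positivity
    refine ⟨Metric.ball ρ δ, mem_nhdsWithin_of_mem_nhds (Metric.ball_mem_nhds ρ hδ0), √q / 2,
      by positivity, ?_⟩
    filter_upwards [hev, eventually_gt_atTop 0] with n hn hn0 ρ' hρ' hI
    have hn' : (0 : ℝ) < n := by exact_mod_cast hn0
    have h1 : q < 1 / (n : ℝ) * ∑ t, (meanVec x b s n ρ t - m n t) ^ 2 := by exact_mod_cast hn
    have h2 : ∑ t, (meanVec x b s n ρ t - m n t) ^ 2 =
        vecNorm (m n - meanVec x b s n ρ) ^ 2 := by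
      rw [vecNorm_sq, dotProduct]
      exact Finset.sum_congr rfl fun t _ => by simp only [Pi.sub_apply]; ring
    rw [h2, one_div_mul_eq_div, lt_div_iff₀ hn'] at h1
    have h3 : √q * √n ≤ vecNorm (m n - meanVec x b s n ρ) := by
      refine (sq_le_sq₀ (by positivity) (vecNorm_nonneg _)).1 ?_
      rw [mul_pow, Real.sq_sqrt hq0'.le, Real.sq_sqrt hn'.le]
      exact h1.le
    have h4 := vecNorm_meanVec_sub_le x b s (n := n) hγ (abs_le_of_mem_Icc hI)
      (abs_le_of_mem_Icc hρ)
    have h5 : vecNorm (m n - meanVec x b s n ρ) ≤ vecNorm (m n - meanVec x b s n ρ') +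
        vecNorm (meanVec x b s n ρ' - meanVec x b s n ρ) := by
      have := vecNorm_add_le (m n - meanVec x b s n ρ') (meanVec x b s n ρ' - meanVec x b s n ρ)
      rwa [sub_add_sub_cancel] at this
    have h6 : γ⁻¹ * (|ρ - ρ'| * (γ⁻¹ * vecNorm (designZ x s n 0 *ᵥ b s))) ≤
        γ⁻¹ * (δ * (γ⁻¹ * ((C + 1) * √n))) := by
      have hd : |ρ - ρ'| ≤ δ := by
        rw [abs_sub_comm, ← Real.dist_eq]
        exact (Metric.mem_ball.1 hρ').le
      have : vecNorm (designZ x s n 0 *ᵥ b s) ≤ (C + 1) * √n :=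
        (hC n).trans (mul_le_mul_of_nonneg_right (by linarith) (Real.sqrt_nonneg _))
      have := vecNorm_nonneg (designZ x s n 0 *ᵥ b s)
      gcongr
    have h7 : γ⁻¹ * (δ * (γ⁻¹ * ((C + 1) * √n))) = √q / 2 * √n := by
      rw [hδ]
      field_simp
    linarith

/-! ### The scaled logarithm of the Bayes factor along a regular data sequence -/

lemma abs_log_sub_log_le {a c l : ℝ} (hl : 0 < l) (ha : l ≤ a) (hc : l ≤ c) :
    |Real.log a - Real.log c| ≤ |a - c| / l := by
  wlog h : c ≤ a generalizing a c
  · rw [abs_sub_comm, abs_sub_comm a]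
    exact this hc ha (le_of_not_ge h)
  have ha' := hl.trans_le ha
  have hc' := hl.trans_le hc
  rw [abs_of_nonneg (sub_nonneg.2 (Real.log_le_log hc' h)), abs_of_nonneg (sub_nonneg.2 h),
    ← Real.log_div ha'.ne' hc'.ne']
  calc _ ≤ a / c - 1 := Real.log_le_sub_one_of_pos (by positivity)
    _ = (a - c) / c := by rw [sub_div, div_self hc'.ne']
    _ ≤ (a - c) / l := div_le_div_of_nonneg_left (sub_nonneg.2 h) hl hc

/-- The bounds of the design and of the prior of the candidate `s` and of the true model `s₀`
which the comparison of the two models uses. -/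
structure BoundedDesign {p : ℕ} (x : ℕ → Fin p → ℝ) (b : (s : Finset (Fin p)) → s → ℝ)
    (g : ℕ → ℝ) (s s₀ : Finset (Fin p)) (ρ₀ γ v₀ C G : ℝ) : Prop where
  γ_pos : 0 < γ
  v_pos : 0 < v₀
  C_nonneg : 0 ≤ C
  abs_ρ₀_le : |ρ₀| ≤ 1 - γ
  g_nonneg : ∀ n, 0 ≤ g n
  g_le : ∀ᶠ n in atTop, g n ≤ G
  mean_le : ∀ n : ℕ, vecNorm (meanVec x b s₀ n ρ₀) ≤ C * √n
  design_le : ∀ n : ℕ, vecNorm (designZ x s n 0 *ᵥ b s) ≤ C * √n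
  det_ne : ∀ᶠ n in atTop, ((designZ x s n 0)ᵀ * designZ x s n 0).det ≠ 0
  det_ne_true : ∀ᶠ n in atTop, ((designZ x s₀ n 0)ᵀ * designZ x s₀ n 0).det ≠ 0

/-- The fluctuation of the residual form of the model `s` for data `y` from the model `s₀`. -/
def dataFluctuation {p : ℕ} (x : ℕ → Fin p → ℝ) (b : (s : Finset (Fin p)) → s → ℝ) (g : ℕ → ℝ)
    (s s₀ : Finset (Fin p)) (ρ₀ v₀ : ℝ) (n : ℕ) (y : Fin n → ℝ) : ℝ :=
  fluctuation x b s n (meanVec x b s₀ n ρ₀) (v₀ • scaleMat x g s₀ n ρ₀) (y - meanVec x b s₀ n ρ₀)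

/-- A data sequence along which the fluctuations are negligible. -/
def RegularData {p : ℕ} (x : ℕ → Fin p → ℝ) (b : (s : Finset (Fin p)) → s → ℝ) (g : ℕ → ℝ)
    (s s₀ : Finset (Fin p)) (ρ₀ v₀ : ℝ) (y : (n : ℕ) → EuclideanSpace ℝ (Fin n)) : Prop :=
  Tendsto (fun n : ℕ => dataFluctuation x b g s s₀ ρ₀ v₀ n (y n).ofLp / n) atTop (nhds 0)

section Regular

variable {p : ℕ} {x : ℕ → Fin p → ℝ} {b : (s : Finset (Fin p)) → s → ℝ} {g : ℕ → ℝ}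
  {s s₀ : Finset (Fin p)} {ρ₀ γ v₀ C G : ℝ}

lemma BoundedDesign.abs_le_one (hD : BoundedDesign x b g s s₀ ρ₀ γ v₀ C G) {ρ : ℝ}
    (hρ : |ρ| ≤ 1 - γ) : |ρ| ≤ 1 := by
  linarith [hD.γ_pos]

lemma BoundedDesign.G_nonneg (hD : BoundedDesign x b g s s₀ ρ₀ γ v₀ C G) : 0 ≤ G := by
  obtain ⟨n, hn⟩ := hD.g_le.exists
  exact (hD.g_nonneg n).trans hn

/-- The noise contributes at least `v₀ n`; the mean difference loses at most a factor `γ²` in the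
whitening and `1 + 4 g` in the precision matrix. -/
lemma le_limitForm (hD : BoundedDesign x b g s s₀ ρ₀ γ v₀ C G) (n : ℕ) {ρ : ℝ}
    (hρ : |ρ| ≤ 1 - γ) :
    v₀ * n + (γ * vecNorm (meanVec x b s₀ n ρ₀ - meanVec x b s n ρ)) ^ 2 / (1 + 4 * g n) ≤
      limitForm x b g s n (meanVec x b s₀ n ρ₀) (v₀ • scaleMat x g s₀ n ρ₀) ρ := by
  have hg := hD.g_nonneg n
  rw [limitForm, Matrix.mul_smul, Matrix.trace_smul, smul_eq_mul, add_comm]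
  refine add_le_add ?_ (mul_le_mul_of_nonneg_left
    (le_trace_ar1Inv_scaleMat x g s₀ hg ρ ρ₀) hD.v_pos.le)
  rw [div_le_iff₀ (by positivity), mul_comm _ (1 + 4 * g n)]
  refine le_trans ?_ (dotProduct_precision_bounds x g s hg (hD.abs_le_one hρ) _).1
  rw [← vecNorm_sq]
  exact pow_le_pow_left₀ (mul_nonneg hD.γ_pos.le (vecNorm_nonneg _))
    (le_vecNorm_ar1Inv hD.γ_pos.le hρ _) 2

lemma mul_le_limitForm (hD : BoundedDesign x b g s s₀ ρ₀ γ v₀ C G) (n : ℕ) {ρ : ℝ}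
    (hρ : |ρ| ≤ 1 - γ) :
    v₀ * n ≤ limitForm x b g s n (meanVec x b s₀ n ρ₀) (v₀ • scaleMat x g s₀ n ρ₀) ρ := by
  refine le_trans (le_add_of_nonneg_right ?_) (le_limitForm hD n hρ)
  have := hD.g_nonneg n
  positivity

lemma dotProduct_covariance_le (hD : BoundedDesign x b g s s₀ ρ₀ γ v₀ C G) :
    ∀ᶠ n in atTop, ∀ u : Fin n → ℝ,
      u ⬝ᵥ (v₀ • scaleMat x g s₀ n ρ₀) *ᵥ u ≤ (v₀ * (1 / γ ^ 2 + G)) * (u ⬝ᵥ u) := by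
  filter_upwards [hD.g_le] with n hn u
  rw [Matrix.smul_mulVec, dotProduct_smul, smul_eq_mul, mul_assoc]
  refine mul_le_mul_of_nonneg_left ?_ hD.v_pos.le
  refine (dotProduct_scaleMat_le x g s₀ n ρ₀ (hD.g_nonneg n) hD.γ_pos hD.abs_ρ₀_le u).trans ?_
  exact mul_le_mul_of_nonneg_right (by linarith) (zero_le_dotProduct_self u)

lemma limitForm_le (hD : BoundedDesign x b g s s₀ ρ₀ γ v₀ C G) :
    ∀ᶠ n in atTop, ∀ ρ : ℝ, |ρ| ≤ 1 - γ →
      limitForm x b g s n (meanVec x b s₀ n ρ₀) (v₀ • scaleMat x g s₀ n ρ₀) ρ ≤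
        (9 * C ^ 2 + 4 * (v₀ * (1 / γ ^ 2 + G))) * n := by
  filter_upwards [dotProduct_covariance_le hD] with n hn ρ hρ
  have hρ1 := hD.abs_le_one hρ
  have hG := hD.G_nonneg
  have hv := hD.v_pos
  rw [limitForm, add_mul]
  refine add_le_add ?_ (trace_ar1Inv_le hρ1 (by positivity) hn)
  refine (dotProduct_precision_bounds x g s (hD.g_nonneg n) hρ1 _).2.trans ?_
  rw [← vecNorm_sq]
  have h1 := vecNorm_whitenedMeanDiff_le x b s (meanVec x b s₀ n ρ₀) hρ1
  have h2 := hD.mean_le n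
  have h3 := hD.design_le n
  calc _ ≤ (3 * C * √n) ^ 2 := pow_le_pow_left₀ (vecNorm_nonneg _) (by linarith) 2
    _ = 9 * C ^ 2 * n := by
      rw [mul_pow, Real.sq_sqrt n.cast_nonneg]
      ring

lemma abs_residualForm_sub_le (hD : BoundedDesign x b g s s₀ ρ₀ γ v₀ C G) :
    ∀ᶠ n in atTop, ∀ (y : Fin n → ℝ) (ρ : ℝ), |ρ| ≤ 1 - γ →
      |residualForm x b g s n ρ y -
        limitForm x b g s n (meanVec x b s₀ n ρ₀) (v₀ • scaleMat x g s₀ n ρ₀) ρ| ≤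
      dataFluctuation x b g s s₀ ρ₀ v₀ n y := by
  filter_upwards [hD.det_ne] with n hn y ρ hρ
  exact abs_residualForm_sub_limitForm_le x b g s (hD.g_nonneg n) hn _ _ _ (hD.abs_le_one hρ)

/-- The denominator of the Bayes factor is treated as the candidate `s₀`. The constant doubles
because `X b = A μ` and `A` has norm at most two. -/
lemma BoundedDesign.trueModel (hD : BoundedDesign x b g s s₀ ρ₀ γ v₀ C G) :
    ∃ C', BoundedDesign x b g s₀ s₀ ρ₀ γ v₀ C' G := by
  refine ⟨2 * C, hD.γ_pos, hD.v_pos, mul_nonneg zero_le_two hD.C_nonneg, hD.abs_ρ₀_le,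
    hD.g_nonneg, hD.g_le, fun n => ?_, fun n => ?_, hD.det_ne_true, hD.det_ne_true⟩
  · refine (hD.mean_le n).trans (mul_le_mul_of_nonneg_right ?_ (Real.sqrt_nonneg _))
    linarith [hD.C_nonneg]
  · rw [← mulVec_meanVec x s₀ n ρ₀]
    refine (vecNorm_ar1Inv_le (hD.abs_le_one hD.abs_ρ₀_le) _).trans ?_
    linarith [hD.mean_le n]

/-- The logarithms of the residual forms of two regular data sequences are uniformly close. -/
lemma exists_tendsto_log_residualForm (hD : BoundedDesign x b g s s₀ ρ₀ γ v₀ C G) {β : ℝ}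
    (hβ : 0 < β) {y y' : (n : ℕ) → EuclideanSpace ℝ (Fin n)}
    (hy : RegularData x b g s s₀ ρ₀ v₀ y) (hy' : RegularData x b g s s₀ ρ₀ v₀ y') :
    ∃ Δ : ℕ → ℝ, Tendsto Δ atTop (nhds 0) ∧ ∀ᶠ n in atTop, ∀ ρ : ℝ, |ρ| ≤ 1 - γ →
      |Real.log (β + residualForm x b g s n ρ (y n).ofLp / 2) -
        Real.log (β + residualForm x b g s n ρ (y' n).ofLp / 2)| ≤ Δ n := by
  have hv := hD.v_pos
  refine ⟨fun n => 2 / v₀ * (dataFluctuation x b g s s₀ ρ₀ v₀ n (y n).ofLp / n +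
    dataFluctuation x b g s s₀ ρ₀ v₀ n (y' n).ofLp / n), ?_, ?_⟩
  · simpa using (Tendsto.add hy hy').const_mul (2 / v₀)
  filter_upwards [abs_residualForm_sub_le hD, Tendsto.eventually hy (gt_mem_nhds (half_pos hv)),
    Tendsto.eventually hy' (gt_mem_nhds (half_pos hv)), eventually_gt_atTop 0]
    with n h1 h2 h3 hn ρ hρ
  have hn' : (0 : ℝ) < n := by exact_mod_cast hn
  rw [div_lt_iff₀ hn'] at h2 h3
  have h4 := abs_le.1 (h1 (y n).ofLp ρ hρ)
  have h5 := abs_le.1 (h1 (y' n).ofLp ρ hρ)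
  have h6 := mul_le_limitForm hD n hρ
  -- Both residual forms exceed `v₀ n / 2` eventually, so the arguments of the logarithms exceed `v₀
  -- n / 4`, where the logarithm has Lipschitz constant `4 / (v₀ n)`.
  have hl : 0 < v₀ * n / 4 := by positivity
  refine (abs_log_sub_log_le hl (by linarith [h4.1]) (by linarith [h5.1])).trans ?_
  rw [div_le_iff₀ hl]
  have h7 : 2 / v₀ * (dataFluctuation x b g s s₀ ρ₀ v₀ n (y n).ofLp / n +
      dataFluctuation x b g s s₀ ρ₀ v₀ n (y' n).ofLp / n) * (v₀ * n / 4) =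
      (dataFluctuation x b g s s₀ ρ₀ v₀ n (y n).ofLp +
      dataFluctuation x b g s s₀ ρ₀ v₀ n (y' n).ofLp) / 2 := by
    field_simp
    ring
  rw [h7, abs_le]
  constructor <;> linarith [h4.1, h4.2, h5.1, h5.2]

lemma exponent_bounds {α : ℝ} (hα : 0 < α) {n : ℕ} (hn : 0 < n) :
    1 / 2 ≤ 1 / (n : ℝ) * (α + n / 2) ∧ 1 / (n : ℝ) * (α + n / 2) ≤ α + 1 := by
  have hn' : (1 : ℝ) ≤ n := by exact_mod_cast hn
  rw [one_div_mul_eq_div]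
  constructor
  · rw [le_div_iff₀ (by positivity)]
    linarith
  · rw [div_le_iff₀ (by positivity)]
    nlinarith

lemma exists_tendsto_log_bayesFactor (hD : BoundedDesign x b g s s₀ ρ₀ γ v₀ C G) {α β : ℝ}
    (hα : 0 < α) (hβ : 0 < β) {y y' : (n : ℕ) → EuclideanSpace ℝ (Fin n)}
    (hy : RegularData x b g s s₀ ρ₀ v₀ y) (hy' : RegularData x b g s s₀ ρ₀ v₀ y')
    (hy₀ : RegularData x b g s₀ s₀ ρ₀ v₀ y) (hy₀' : RegularData x b g s₀ s₀ ρ₀ v₀ y') :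
    ∃ Δ : ℕ → ℝ, Tendsto Δ atTop (nhds 0) ∧ ∀ᶠ n : ℕ in atTop, ∀ ρ : ℝ, |ρ| ≤ 1 - γ →
      |1 / (n : ℝ) * Real.log (bayesFactor x b g α β s s₀ ρ₀ n ρ (y n)) -
        1 / (n : ℝ) * Real.log (bayesFactor x b g α β s s₀ ρ₀ n ρ (y' n))| ≤ Δ n := by
  obtain ⟨C', hD₀⟩ := hD.trueModel
  obtain ⟨Δ, hΔ, h⟩ := exists_tendsto_log_residualForm hD hβ hy hy'
  obtain ⟨Δ₀, hΔ₀, h₀⟩ := exists_tendsto_log_residualForm hD₀ hβ hy₀ hy₀'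
  refine ⟨fun n => (α + 1) * (Δ₀ n + Δ n), by simpa using (hΔ₀.add hΔ).const_mul (α + 1), ?_⟩
  filter_upwards [h, h₀, eventually_gt_atTop 0] with n h h₀ hn ρ hρ
  obtain ⟨h1, h2⟩ := exponent_bounds hα hn
  have h3 := h ρ hρ
  have h4 := h₀ ρ₀ hD.abs_ρ₀_le
  rw [log_bayesFactor x b g s n ρ s₀ ρ₀ (hD.g_nonneg n) hα hβ,
    log_bayesFactor x b g s n ρ s₀ ρ₀ (hD.g_nonneg n) hα hβ]
  set A := Real.log (β + residualForm x b g s n ρ (y n).ofLp / 2)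
  set A' := Real.log (β + residualForm x b g s n ρ (y' n).ofLp / 2)
  set A₀ := Real.log (β + residualForm x b g s₀ n ρ₀ (y n).ofLp / 2)
  set A₀' := Real.log (β + residualForm x b g s₀ n ρ₀ (y' n).ofLp / 2)
  set d := 1 / 2 * (Real.log (scaleMat x g s₀ n ρ₀).det - Real.log (scaleMat x g s n ρ).det)
  have h5 : 1 / (n : ℝ) * (d + (α + n / 2) * (A₀ - A)) -
      1 / (n : ℝ) * (d + (α + n / 2) * (A₀' - A')) =
      1 / (n : ℝ) * (α + n / 2) * ((A₀ - A₀') - (A - A')) := by ring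
  rw [h5, abs_mul, abs_of_nonneg (by linarith)]
  exact mul_le_mul h2 ((abs_sub _ _).trans (add_le_add h4 h3)) (abs_nonneg _) (by linarith)

lemma tendsto_residualForm_true (hD : BoundedDesign x b g s₀ s₀ ρ₀ γ v₀ C G)
    {y : (n : ℕ) → EuclideanSpace ℝ (Fin n)} (hy : RegularData x b g s₀ s₀ ρ₀ v₀ y) :
    Tendsto (fun n : ℕ => residualForm x b g s₀ n ρ₀ (y n).ofLp / n) atTop (nhds v₀) := by
  have hG := hD.G_nonneg
  have hv := hD.v_pos
  have h1 : Tendsto (fun n : ℕ => v₀ * (G * (4 * p)) / n +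
      dataFluctuation x b g s₀ s₀ ρ₀ v₀ n (y n).ofLp / n) atTop (nhds 0) := by
    simpa using (tendsto_const_div_atTop_nhds_zero_nat (v₀ * (G * (4 * p)))).add hy
  rw [tendsto_iff_dist_tendsto_zero]
  refine tendsto_of_tendsto_of_tendsto_of_le_of_le' tendsto_const_nhds h1
    (Eventually.of_forall fun n => dist_nonneg) ?_
  filter_upwards [abs_residualForm_sub_le hD, hD.g_le, eventually_gt_atTop 0] with n h2 h3 hn
  have hn' : (0 : ℝ) < n := by exact_mod_cast hn
  have h4 := h2 (y n).ofLp ρ₀ hD.abs_ρ₀_le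
  rw [limitForm_true] at h4
  have h5 := trace_whitenedProj_nonneg x s₀ n ρ₀
  have h6 : g n * (whitenedProj x s₀ n ρ₀).trace ≤ G * (4 * p) :=
    mul_le_mul h3 (trace_whitenedProj_le x s₀ n (hD.abs_le_one hD.abs_ρ₀_le)) h5 hG
  have h7 := mul_nonneg (hD.g_nonneg n) h5
  rw [Real.dist_eq, ← add_div, div_sub' hn'.ne', abs_div, abs_of_pos hn']
  refine div_le_div_of_nonneg_right ?_ hn'.le
  have h8 := mul_le_mul_of_nonneg_left h6 hv.le
  have h9 := mul_nonneg hv.le h7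
  rw [abs_le] at *
  constructor <;> linarith [h4.1, h4.2]

lemma log_det_bounds (hD : BoundedDesign x b g s s₀ ρ₀ γ v₀ C G) (t : Finset (Fin p)) :
    ∀ᶠ n in atTop, ∀ ρ : ℝ, |ρ| ≤ 1 - γ → 0 ≤ Real.log (scaleMat x g t n ρ).det ∧
      Real.log (scaleMat x g t n ρ).det ≤ G * (4 * p) := by
  filter_upwards [hD.g_le] with n hn ρ hρ
  have h1 := one_le_det_scaleMat x g t n ρ (hD.g_nonneg n)
  refine ⟨Real.log_nonneg h1, ?_⟩
  rw [Real.log_le_iff_le_exp (by linarith)]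
  refine (det_scaleMat_le x g t n ρ (hD.g_nonneg n) (hD.abs_le_one hρ)).trans ?_
  exact Real.exp_le_exp.2 (mul_le_mul_of_nonneg_right hn (by positivity))

/-- Of the gap `c` between `Q₀ / N` and `Q / N`, four errors of size `c / 6` are given away: the
approximation of each form and the term `2β` on each side. The gap from `v + c/3` to `v + 2c/3`
remains. -/
lemma log_sub_log_bounds {β v c U N Q₀ Q : ℝ} (hβ : 0 < β) (hv : 0 < v) (hc : 0 < c)
    (hN : 0 < N) (h1 : Q₀ ≤ (v + c / 6) * N) (h2 : v / 2 * N ≤ Q₀)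
    (h3 : 2 * β ≤ c / 6 * N) (h4 : 2 * β ≤ 1 * N) (h5 : (v + 5 * c / 6) * N ≤ Q)
    (h6 : Q ≤ (U + 1) * N) :
    -|Real.log (v / 2) - Real.log (U + 2)| ≤ Real.log (β + Q₀ / 2) - Real.log (β + Q / 2) ∧
      Real.log (β + Q₀ / 2) - Real.log (β + Q / 2) ≤
        -(2 * ((Real.log (v + 2 * c / 3) - Real.log (v + c / 3)) / 2)) := by
  have hvN : 0 < v * N := by positivity
  have hcN : 0 < c * N := by positivity
  have hscale : ∀ w : ℝ, 0 < w → Real.log (β + w / 2) =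
      Real.log ((2 * β + w) / N) + Real.log (N / 2) := by
    intro w hw
    rw [← Real.log_mul (by positivity) (by positivity)]
    congr 1
    field_simp
  have hQ₀ : 0 < Q₀ := by linarith
  have hQ : 0 < Q := by linarith
  rw [hscale Q₀ hQ₀, hscale Q hQ]
  have a1 : Real.log ((2 * β + Q₀) / N) ≤ Real.log (v + c / 3) := by
    refine Real.log_le_log (by positivity) ?_
    rw [div_le_iff₀ hN]
    linarith
  have a2 : Real.log (v + 2 * c / 3) ≤ Real.log ((2 * β + Q) / N) := by
    refine Real.log_le_log (by positivity) ?_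
    rw [le_div_iff₀ hN]
    linarith
  have a3 : Real.log (v / 2) ≤ Real.log ((2 * β + Q₀) / N) := by
    refine Real.log_le_log (by positivity) ?_
    rw [le_div_iff₀ hN]
    linarith
  have a4 : Real.log ((2 * β + Q) / N) ≤ Real.log (U + 2) := by
    refine Real.log_le_log (by positivity) ?_
    rw [div_le_iff₀ hN]
    linarith
  have := neg_abs_le (Real.log (v / 2) - Real.log (U + 2))
  constructor <;> linarith

/-- Uniform bounds for the scaled logarithm of the Bayes factor. -/
lemma exists_log_bayesFactor_bounds (hD : BoundedDesign x b g s s₀ ρ₀ γ v₀ C G) {α β : ℝ}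
    (hα : 0 < α) (hβ : 0 < β) {η : ℝ} (hη : 0 < η)
    (hsep : ∀ᶠ n : ℕ in atTop, ∀ ρ ∈ Icc (-1 + γ) (1 - γ),
      η * √n ≤ vecNorm (meanVec x b s₀ n ρ₀ - meanVec x b s n ρ))
    {y : (n : ℕ) → EuclideanSpace ℝ (Fin n)} (hy : RegularData x b g s s₀ ρ₀ v₀ y)
    (hy₀ : RegularData x b g s₀ s₀ ρ₀ v₀ y) :
    ∃ ζ > 0, ∃ M, ∀ᶠ n : ℕ in atTop, ∀ ρ ∈ Icc (-1 + γ) (1 - γ),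
      -M ≤ 1 / (n : ℝ) * Real.log (bayesFactor x b g α β s s₀ ρ₀ n ρ (y n)) ∧
      1 / (n : ℝ) * Real.log (bayesFactor x b g α β s s₀ ρ₀ n ρ (y n)) ≤ -ζ := by
  obtain ⟨C', hD₀⟩ := hD.trueModel
  have hG := hD.G_nonneg
  have hv := hD.v_pos
  have hγ := hD.γ_pos
  set c := (γ * η) ^ 2 / (1 + 4 * G) with hc
  have hc0 : 0 < c := by positivity
  set U := 9 * C ^ 2 + 4 * (v₀ * (1 / γ ^ 2 + G)) with hU
  -- Half of the logarithmic gap: the residual forms contribute at most `-ζ`, the determinants at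
  -- most `ζ / 2`, which leaves the rate `ζ / 2`.
  set ζ := (Real.log (v₀ + 2 * c / 3) - Real.log (v₀ + c / 3)) / 2 with hζ
  have hζ0 : 0 < ζ := half_pos (sub_pos.2 (Real.log_lt_log (by positivity) (by linarith)))
  set M₁ := |Real.log (v₀ / 2) - Real.log (U + 2)| with hM₁
  refine ⟨ζ / 2, half_pos hζ0, G * (4 * p) + (α + 1) * M₁, ?_⟩
  have hQ₀ := tendsto_residualForm_true hD₀ hy₀
  have hβn : Tendsto (fun n : ℕ => 2 * β / n) atTop (nhds 0) :=
    tendsto_const_div_atTop_nhds_zero_nat _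
  have hdn : Tendsto (fun n : ℕ => G * (4 * p) / n) atTop (nhds 0) :=
    tendsto_const_div_atTop_nhds_zero_nat _
  filter_upwards [hsep, abs_residualForm_sub_le hD, limitForm_le hD, log_det_bounds hD s,
    log_det_bounds hD s₀, hD.g_le, eventually_gt_atTop 0,
    hQ₀.eventually (gt_mem_nhds (show v₀ < v₀ + c / 6 by linarith)),
    hQ₀.eventually (lt_mem_nhds (show v₀ / 2 < v₀ by linarith)),
    Tendsto.eventually hy (gt_mem_nhds (show 0 < c / 6 by linarith)),
    Tendsto.eventually hy (gt_mem_nhds one_pos),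
    hβn.eventually (gt_mem_nhds (show 0 < c / 6 by linarith)),
    hβn.eventually (gt_mem_nhds one_pos),
    hdn.eventually (gt_mem_nhds hζ0)]
    with n k1 k2 k3 k4 k5 k6 hn k7 k8 k9 k10 k11 k12 k13 ρ hρ
  have hn' : (0 : ℝ) < n := by exact_mod_cast hn
  have hn1 : (1 : ℝ) ≤ n := by exact_mod_cast hn
  have hρ' := abs_le_of_mem_Icc hρ
  obtain ⟨e1, e2⟩ := exponent_bounds hα hn
  obtain ⟨d1, d2⟩ := k4 ρ hρ'
  obtain ⟨d3, d4⟩ := k5 ρ₀ hD.abs_ρ₀_le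
  have r1 := abs_le.1 (k2 (y n).ofLp ρ hρ')
  have r2 := k3 ρ hρ'
  have r3 := le_limitForm hD n hρ'
  have r4 : c * n ≤
      (γ * vecNorm (meanVec x b s₀ n ρ₀ - meanVec x b s n ρ)) ^ 2 / (1 + 4 * g n) := by
    have hgn := hD.g_nonneg n
    have : c * n = (γ * (η * √n)) ^ 2 / (1 + 4 * G) := by
      rw [hc, ← mul_assoc, mul_pow _ (√n), Real.sq_sqrt hn'.le]
      ring
    rw [this]
    have := k1 ρ hρ
    gcongr
  rw [div_lt_iff₀ hn'] at k9 k10 k11 k12 k13 k7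
  rw [lt_div_iff₀ hn'] at k8
  rw [log_bayesFactor x b g s n ρ s₀ ρ₀ (hD.g_nonneg n) hα hβ]
  set Q := residualForm x b g s n ρ (y n).ofLp
  set Q₀ := residualForm x b g s₀ n ρ₀ (y n).ofLp
  set F := dataFluctuation x b g s s₀ ρ₀ v₀ n (y n).ofLp
  have hvn : 0 < v₀ * n := by positivity
  obtain ⟨hlo, hup⟩ := log_sub_log_bounds (U := U) (Q := Q) hβ hv hc0 hn' k7.le k8.le k11.le k12.le
    (by linarith [r1.1]) (by linarith [r1.2])
  rw [← hM₁] at hlo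
  set r := Real.log (β + Q₀ / 2) - Real.log (β + Q / 2) with hr
  set D := Real.log (scaleMat x g s n ρ).det
  set D₀ := Real.log (scaleMat x g s₀ n ρ₀).det
  have hexp : 1 / (n : ℝ) * (1 / 2 * (D₀ - D) + (α + n / 2) * r) =
      1 / 2 * ((D₀ - D) / n) + 1 / (n : ℝ) * (α + n / 2) * r := by ring
  rw [hexp]
  set κ := 1 / (n : ℝ) * (α + n / 2)
  have hM0 : 0 ≤ M₁ := abs_nonneg _
  have hdet1 : (D₀ - D) / n ≤ ζ := by
    rw [div_le_iff₀ hn']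
    linarith
  have hdet2 : -(G * (4 * p)) ≤ (D₀ - D) / n := by
    rw [le_div_iff₀ hn']
    have : 0 ≤ G * (4 * p) := by positivity
    nlinarith
  constructor
  · have h1 : κ * -M₁ ≤ κ * r := mul_le_mul_of_nonneg_left hlo (by linarith)
    have h2 : κ * M₁ ≤ (α + 1) * M₁ := mul_le_mul_of_nonneg_right e2 hM0
    have : 0 ≤ G * (4 * p) := by positivity
    linarith
  · have h1 : κ * r ≤ κ * -(2 * ζ) := mul_le_mul_of_nonneg_left hup (by linarith)
    have h2 : 1 / 2 * (2 * ζ) ≤ κ * (2 * ζ) := mul_le_mul_of_nonneg_right e1 (by linarith)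
    linarith

end Regular

/-! ### The integrated Bayes factor -/

lemma limsup_coe_le_of_tendsto_sub {u v : ℕ → ℝ}
    (h : Tendsto (fun n => u n - v n) atTop (nhds 0)) :
    limsup (fun n => (u n : EReal)) atTop ≤ limsup (fun n => (v n : EReal)) atTop := by
  have h0 : limsup (fun n => ((u n - v n : ℝ) : EReal)) atTop = 0 := by
    have : Tendsto (fun n => ((u n - v n : ℝ) : EReal)) atTop (nhds ((0 : ℝ) : EReal)) :=
      (continuous_coe_real_ereal.tendsto 0).comp h
    exact this.limsup_eq
  have heq : (fun n => (u n : EReal)) =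
      (fun n => (v n : EReal)) + fun n => ((u n - v n : ℝ) : EReal) := by
    ext n
    rw [Pi.add_apply, ← EReal.coe_add, add_sub_cancel]
  rw [heq]
  refine (EReal.limsup_add_le (Or.inr ?_) (Or.inr ?_)).trans ?_
  · rw [h0]; exact EReal.zero_ne_top
  · rw [h0]; exact EReal.zero_ne_bot
  · rw [h0, add_zero]

lemma limsup_coe_eq_of_tendsto_sub {u v : ℕ → ℝ}
    (h : Tendsto (fun n => u n - v n) atTop (nhds 0)) :
    limsup (fun n => (u n : EReal)) atTop = limsup (fun n => (v n : EReal)) atTop := by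
  refine le_antisymm (limsup_coe_le_of_tendsto_sub h) (limsup_coe_le_of_tendsto_sub ?_)
  have := h.neg
  rw [neg_zero] at this
  exact this.congr fun n => by ring

section Integrated

variable {p : ℕ} (x : ℕ → Fin p → ℝ) (b : (s : Finset (Fin p)) → s → ℝ) (g : ℕ → ℝ)
  (s s₀ : Finset (Fin p)) (ρ₀ : ℝ) {γ α β : ℝ} {π : ℝ → ℝ} {n : ℕ}

lemma integrableOn_bayesFactor_mul (hg : 0 ≤ g n) (hα : 0 < α) (hβ : 0 < β)
    (hπ : IntegrableOn π (Icc (-1 + γ) (1 - γ))) (y : EuclideanSpace ℝ (Fin n)) {c : ℝ}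
    (hc : ∀ ρ ∈ Icc (-1 + γ) (1 - γ), bayesFactor x b g α β s s₀ ρ₀ n ρ y ≤ c) :
    IntegrableOn (fun ρ => bayesFactor x b g α β s s₀ ρ₀ n ρ y * π ρ) (Icc (-1 + γ) (1 - γ)) := by
  refine Integrable.bdd_mul (c := c) hπ
    (measurable_bayesFactor x b g s n s₀ ρ₀ hg hα hβ y).aestronglyMeasurable ?_
  filter_upwards [ae_restrict_mem measurableSet_Icc] with ρ hρ
  rw [Real.norm_of_nonneg (bayesFactor_pos x b g s n ρ s₀ ρ₀ hg hα hβ y).le]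
  exact hc ρ hρ

lemma one_div_mul_log_le_iff {n : ℕ} (hn : 0 < n) {a c : ℝ} (ha : 0 < a) :
    1 / (n : ℝ) * Real.log a ≤ c ↔ a ≤ Real.exp (n * c) := by
  have hn' : (0 : ℝ) < n := by exact_mod_cast hn
  rw [one_div_mul_eq_div, div_le_iff₀ hn', mul_comm, Real.log_le_iff_le_exp ha]

lemma le_one_div_mul_log_iff {n : ℕ} (hn : 0 < n) {a c : ℝ} (ha : 0 < a) :
    c ≤ 1 / (n : ℝ) * Real.log a ↔ Real.exp (n * c) ≤ a := by
  have hn' : (0 : ℝ) < n := by exact_mod_cast hn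
  rw [one_div_mul_eq_div, le_div_iff₀ hn', mul_comm, Real.le_log_iff_exp_le ha]

lemma log_integratedBayesFactor_bounds (hn : 0 < n) (hg : 0 ≤ g n) (hα : 0 < α) (hβ : 0 < β)
    (hπ0 : ∀ ρ, 0 ≤ π ρ) (hπ : IntegrableOn π (Icc (-1 + γ) (1 - γ)))
    (hπ1 : ∫ ρ in Icc (-1 + γ) (1 - γ), π ρ = 1) (y : EuclideanSpace ℝ (Fin n)) {a c : ℝ}
    (h : ∀ ρ ∈ Icc (-1 + γ) (1 - γ),
      a ≤ 1 / (n : ℝ) * Real.log (bayesFactor x b g α β s s₀ ρ₀ n ρ y) ∧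
      1 / (n : ℝ) * Real.log (bayesFactor x b g α β s s₀ ρ₀ n ρ y) ≤ c) :
    0 < integratedBayesFactor x b g α β s s₀ ρ₀ γ π n y ∧
    a ≤ 1 / (n : ℝ) * Real.log (integratedBayesFactor x b g α β s s₀ ρ₀ γ π n y) ∧
      1 / (n : ℝ) * Real.log (integratedBayesFactor x b g α β s s₀ ρ₀ γ π n y) ≤ c := by
  have hpos := fun ρ => bayesFactor_pos x b g s n ρ s₀ ρ₀ hg hα hβ y
  have hup : ∀ ρ ∈ Icc (-1 + γ) (1 - γ),
      bayesFactor x b g α β s s₀ ρ₀ n ρ y ≤ Real.exp (n * c) := fun ρ hρ =>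
    (one_div_mul_log_le_iff hn (hpos ρ)).1 (h ρ hρ).2
  have hlo : ∀ ρ ∈ Icc (-1 + γ) (1 - γ),
      Real.exp (n * a) ≤ bayesFactor x b g α β s s₀ ρ₀ n ρ y := fun ρ hρ =>
    (le_one_div_mul_log_iff hn (hpos ρ)).1 (h ρ hρ).1
  have hint := integrableOn_bayesFactor_mul x b g s s₀ ρ₀ hg hα hβ hπ y hup
  have h1 : Real.exp (n * a) ≤ integratedBayesFactor x b g α β s s₀ ρ₀ γ π n y := by
    calc Real.exp (n * a) = ∫ ρ in Icc (-1 + γ) (1 - γ), Real.exp (n * a) * π ρ := by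
          rw [integral_const_mul, hπ1, mul_one]
      _ ≤ _ := setIntegral_mono_on (hπ.const_mul _) hint measurableSet_Icc fun ρ hρ =>
          mul_le_mul_of_nonneg_right (hlo ρ hρ) (hπ0 ρ)
  have h2 : integratedBayesFactor x b g α β s s₀ ρ₀ γ π n y ≤ Real.exp (n * c) := by
    calc _ ≤ ∫ ρ in Icc (-1 + γ) (1 - γ), Real.exp (n * c) * π ρ :=
          setIntegral_mono_on hint (hπ.const_mul _) measurableSet_Icc fun ρ hρ =>
            mul_le_mul_of_nonneg_right (hup ρ hρ) (hπ0 ρ)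
      _ = _ := by rw [integral_const_mul, hπ1, mul_one]
  have h3 := (Real.exp_pos _).trans_le h1
  exact ⟨h3, (le_one_div_mul_log_iff hn h3).2 h1, (one_div_mul_log_le_iff hn h3).2 h2⟩

/-- A ratio bound `exp (n Δ)` valid for every `ρ` survives integration against `π`. The bound `c`
serves only to make the integrals finite. -/
lemma integratedBayesFactor_le_mul (hn : 0 < n) (hg : 0 ≤ g n) (hα : 0 < α) (hβ : 0 < β)
    (hπ0 : ∀ ρ, 0 ≤ π ρ) (hπ : IntegrableOn π (Icc (-1 + γ) (1 - γ)))
    {y y' : EuclideanSpace ℝ (Fin n)} {c Δ : ℝ}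
    (hc : ∀ ρ ∈ Icc (-1 + γ) (1 - γ), bayesFactor x b g α β s s₀ ρ₀ n ρ y ≤ c)
    (hc' : ∀ ρ ∈ Icc (-1 + γ) (1 - γ), bayesFactor x b g α β s s₀ ρ₀ n ρ y' ≤ c)
    (h : ∀ ρ ∈ Icc (-1 + γ) (1 - γ),
      1 / (n : ℝ) * Real.log (bayesFactor x b g α β s s₀ ρ₀ n ρ y) -
        1 / (n : ℝ) * Real.log (bayesFactor x b g α β s s₀ ρ₀ n ρ y') ≤ Δ)
    (hI : 0 < integratedBayesFactor x b g α β s s₀ ρ₀ γ π n y)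
    (hI' : 0 < integratedBayesFactor x b g α β s s₀ ρ₀ γ π n y') :
    1 / (n : ℝ) * Real.log (integratedBayesFactor x b g α β s s₀ ρ₀ γ π n y) -
      1 / (n : ℝ) * Real.log (integratedBayesFactor x b g α β s s₀ ρ₀ γ π n y') ≤ Δ := by
  have key : ∀ {u v : ℝ}, 0 < u → 0 < v →
      (1 / (n : ℝ) * Real.log u - 1 / (n : ℝ) * Real.log v ≤ Δ ↔ u ≤ Real.exp (n * Δ) * v) := by
    intro u v hu hv
    rw [← mul_sub, ← Real.log_div hu.ne' hv.ne', one_div_mul_log_le_iff hn (div_pos hu hv),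
      div_le_iff₀ hv]
  rw [key hI hI']
  have hint' := integrableOn_bayesFactor_mul x b g s s₀ ρ₀ hg hα hβ hπ y' hc'
  calc _ ≤ ∫ ρ in Icc (-1 + γ) (1 - γ),
        Real.exp (n * Δ) * (bayesFactor x b g α β s s₀ ρ₀ n ρ y' * π ρ) := by
        refine setIntegral_mono_on (integrableOn_bayesFactor_mul x b g s s₀ ρ₀ hg hα hβ hπ y hc)
          (hint'.const_mul _) measurableSet_Icc fun ρ hρ => ?_
        rw [← mul_assoc]
        refine mul_le_mul_of_nonneg_right ?_ (hπ0 ρ)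
        exact (key (bayesFactor_pos x b g s n ρ s₀ ρ₀ hg hα hβ y)
          (bayesFactor_pos x b g s n ρ s₀ ρ₀ hg hα hβ y')).1 (h ρ hρ)
    _ = _ := by rw [integral_const_mul, integratedBayesFactor]

variable {x b g s s₀ ρ₀} {v₀ C G : ℝ}

/-- Along two regular data sequences the upper limits agree, and they are negative reals. -/
lemma limsup_integratedBayesFactor (hD : BoundedDesign x b g s s₀ ρ₀ γ v₀ C G)
    (hα : 0 < α) (hβ : 0 < β)
    (hπ0 : ∀ ρ, 0 ≤ π ρ) (hπ : IntegrableOn π (Icc (-1 + γ) (1 - γ)))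
    (hπ1 : ∫ ρ in Icc (-1 + γ) (1 - γ), π ρ = 1) {η : ℝ} (hη : 0 < η)
    (hsep : ∀ᶠ n : ℕ in atTop, ∀ ρ ∈ Icc (-1 + γ) (1 - γ),
      η * √n ≤ vecNorm (meanVec x b s₀ n ρ₀ - meanVec x b s n ρ))
    {y y' : (n : ℕ) → EuclideanSpace ℝ (Fin n)}
    (hy : RegularData x b g s s₀ ρ₀ v₀ y) (hy' : RegularData x b g s s₀ ρ₀ v₀ y')
    (hy₀ : RegularData x b g s₀ s₀ ρ₀ v₀ y) (hy₀' : RegularData x b g s₀ s₀ ρ₀ v₀ y') :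
    (limsup (fun n : ℕ => ((1 / (n : ℝ) *
      Real.log (integratedBayesFactor x b g α β s s₀ ρ₀ γ π n (y n)) : ℝ) : EReal)) atTop =
    limsup (fun n : ℕ => ((1 / (n : ℝ) *
      Real.log (integratedBayesFactor x b g α β s s₀ ρ₀ γ π n (y' n)) : ℝ) : EReal)) atTop) ∧
    ∃ r : ℝ, r < 0 ∧ limsup (fun n : ℕ => ((1 / (n : ℝ) *
      Real.log (integratedBayesFactor x b g α β s s₀ ρ₀ γ π n (y n)) : ℝ) : EReal)) atTop = r := by
  obtain ⟨ζ, hζ, M, hb⟩ := exists_log_bayesFactor_bounds hD hα hβ hη hsep hy hy₀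
  obtain ⟨ζ', hζ', M', hb'⟩ := exists_log_bayesFactor_bounds hD hα hβ hη hsep hy' hy₀'
  obtain ⟨Δ, hΔ, hd⟩ := exists_tendsto_log_bayesFactor hD hα hβ hy hy' hy₀ hy₀'
  constructor
  · apply limsup_coe_eq_of_tendsto_sub
    refine squeeze_zero_norm' ?_ hΔ
    filter_upwards [hb, hb', hd, eventually_gt_atTop 0] with n h1 h2 h3 hn
    have hg := hD.g_nonneg n
    have I1 := (log_integratedBayesFactor_bounds x b g s s₀ ρ₀ hn hg hα hβ hπ0 hπ hπ1 _ h1).1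
    have I2 := (log_integratedBayesFactor_bounds x b g s s₀ ρ₀ hn hg hα hβ hπ0 hπ hπ1 _ h2).1
    have c1 : ∀ ρ ∈ Icc (-1 + γ) (1 - γ), bayesFactor x b g α β s s₀ ρ₀ n ρ (y n) ≤ 1 := by
      intro ρ hρ
      refine ((one_div_mul_log_le_iff hn (bayesFactor_pos x b g s n ρ s₀ ρ₀ hg hα hβ _)).1
        (h1 ρ hρ).2).trans (Real.exp_le_one_iff.2 ?_)
      exact mul_nonpos_of_nonneg_of_nonpos n.cast_nonneg (neg_nonpos.2 hζ.le)
    have c2 : ∀ ρ ∈ Icc (-1 + γ) (1 - γ), bayesFactor x b g α β s s₀ ρ₀ n ρ (y' n) ≤ 1 := by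
      intro ρ hρ
      refine ((one_div_mul_log_le_iff hn (bayesFactor_pos x b g s n ρ s₀ ρ₀ hg hα hβ _)).1
        (h2 ρ hρ).2).trans (Real.exp_le_one_iff.2 ?_)
      exact mul_nonpos_of_nonneg_of_nonpos n.cast_nonneg (neg_nonpos.2 hζ'.le)
    rw [Real.norm_eq_abs, abs_le']
    constructor
    · exact integratedBayesFactor_le_mul x b g s s₀ ρ₀ hn hg hα hβ hπ0 hπ c1 c2
        (fun ρ hρ => (le_abs_self _).trans (h3 ρ (abs_le_of_mem_Icc hρ))) I1 I2
    · rw [neg_sub]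
      exact integratedBayesFactor_le_mul x b g s s₀ ρ₀ hn hg hα hβ hπ0 hπ c2 c1
        (fun ρ hρ => (le_abs_self _).trans
          ((abs_sub_comm _ _).le.trans (h3 ρ (abs_le_of_mem_Icc hρ)))) I2 I1
  · have hI : ∀ᶠ n : ℕ in atTop,
        ((-M : ℝ) : EReal) ≤ ((1 / (n : ℝ) *
          Real.log (integratedBayesFactor x b g α β s s₀ ρ₀ γ π n (y n)) : ℝ) : EReal) ∧
        ((1 / (n : ℝ) * Real.log (integratedBayesFactor x b g α β s s₀ ρ₀ γ π n (y n)) : ℝ) :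
          EReal) ≤ ((-ζ : ℝ) : EReal) := by
      filter_upwards [hb, eventually_gt_atTop 0] with n h1 hn
      obtain ⟨-, h2, h3⟩ := log_integratedBayesFactor_bounds x b g s s₀ ρ₀ hn (hD.g_nonneg n)
        hα hβ hπ0 hπ hπ1 _ h1
      exact ⟨EReal.coe_le_coe_iff.2 h2, EReal.coe_le_coe_iff.2 h3⟩
    have hle := limsup_le_of_le (h := hI.mono fun n h => h.2)
    have hge := le_limsup_of_frequently_le (hI.mono fun n h => h.1).frequently
    set ℓ := limsup (fun n : ℕ => ((1 / (n : ℝ) *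
      Real.log (integratedBayesFactor x b g α β s s₀ ρ₀ γ π n (y n)) : ℝ) : EReal)) atTop
    have htop : ℓ ≠ ⊤ := (hle.trans_lt (EReal.coe_lt_top _)).ne
    have hbot : ℓ ≠ ⊥ := ((EReal.bot_lt_coe _).trans_le hge).ne'
    refine ⟨ℓ.toReal, ?_, (EReal.coe_toReal htop hbot).symm⟩
    have := EReal.toReal_le_toReal hle hbot (EReal.coe_ne_top _)
    rw [EReal.toReal_coe] at this
    linarith

end Integrated

/-! ### Bounded designs and regular data from the model assumptions -/

lemma exists_boundedDesign {p : ℕ} {x : ℕ → Fin p → ℝ} {K : Set (Fin p → ℝ)} (hK : IsCompact K)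
    (hx : ∀ t, x t ∈ K) {γ : ℝ} (hγ : 0 < γ) {ρ₀ : ℝ} (hρ₀ : |ρ₀| < 1 - γ)
    (b : (s : Finset (Fin p)) → s → ℝ) {g : ℕ → ℝ} (hg_pos : ∀ n, 0 < g n)
    (hg : g =O[atTop] fun _ => (1 : ℝ))
    (hZ : ∀ s : Finset (Fin p), ∀ ρ ∈ Icc (-1 + γ) (1 - γ), ∀ᶠ n in atTop,
      ((designZ x s n ρ)ᵀ * designZ x s n ρ).det ≠ 0)
    (s s₀ : Finset (Fin p)) {v₀ : ℝ} (hv₀ : 0 < v₀) :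
    ∃ C G, BoundedDesign x b g s s₀ ρ₀ γ v₀ C G := by
  obtain ⟨C, hC0, hC⟩ := exists_vecNorm_design_le x b s hK hx
  obtain ⟨C₀, hC₀0, hC₀⟩ := exists_vecNorm_design_le x b s₀ hK hx
  obtain ⟨G, hG⟩ := hg.bound
  -- Full rank is used at `ρ = 0` only, that is, for the raw covariates; `|ρ₀| < 1 - γ` puts zero in
  -- the interval.
  have h0 : (0 : ℝ) ∈ Icc (-1 + γ) (1 - γ) := by
    have := (abs_nonneg ρ₀).trans_lt hρ₀
    constructor <;> linarith
  have hγC : 0 ≤ γ⁻¹ * C₀ := mul_nonneg (inv_nonneg.2 hγ.le) hC₀0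
  refine ⟨C + γ⁻¹ * C₀, G, hγ, hv₀, add_nonneg hC0 hγC, hρ₀.le, fun n => (hg_pos n).le, ?_,
    fun n => ?_, fun n => ?_, hZ s 0 h0, hZ s₀ 0 h0⟩
  · filter_upwards [hG] with n hn
    simpa [abs_of_pos (hg_pos n)] using hn
  · refine (meanVec_le x b s₀ hγ hρ₀.le).trans ?_
    have := mul_le_mul_of_nonneg_left (hC₀ n) (inv_nonneg.2 hγ.le)
    have := mul_nonneg hC0 (Real.sqrt_nonneg n)
    linarith
  · have := mul_nonneg hγC (Real.sqrt_nonneg n)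
    linarith [hC n]

lemma ae_regularData {Ω : Type*} [MeasurableSpace Ω] {P : Measure Ω} {p : ℕ}
    {x : ℕ → Fin p → ℝ} {b : (s : Finset (Fin p)) → s → ℝ} {g : ℕ → ℝ} {s s₀ : Finset (Fin p)}
    {ρ₀ γ v₀ C G : ℝ} (hD : BoundedDesign x b g s s₀ ρ₀ γ v₀ C G)
    {Y : (n : ℕ) → Ω → EuclideanSpace ℝ (Fin n)}
    (hY : ∀ᶠ n in atTop, HasLaw (Y n) (modelLaw x b g s₀ n ρ₀ v₀) P) :
    ∀ᵐ ω ∂P, RegularData x b g s s₀ ρ₀ v₀ fun n => Y n ω :=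
  ae_tendsto_fluctuation x b s hY
    (Eventually.of_forall fun n => (scaleMat_posSemidef x g s₀ n ρ₀ (hD.g_nonneg n)).smul
      hD.v_pos.le) (dotProduct_covariance_le hD) hD.mean_le hD.design_le

end

end AR1Selection

/-! ### The almost sure constant -/

theorem mainTheorem8
    {Ω : Type*} [MeasurableSpace Ω] (P : Measure Ω) [IsProbabilityMeasure P]
    (p : ℕ) (hp : 1 < p)
    -- covariates in a compact space
    (x : ℕ → Fin p → ℝ) (K : Set (Fin p → ℝ)) (hK : IsCompact K) (hx : ∀ t, x t ∈ K)
    -- the prior of the autoregression coefficient and its true value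
    (γ : ℝ) (hγ : 0 < γ)
    (π : ℝ → ℝ) (hπ_nonneg : ∀ ρ, 0 ≤ π ρ) (hπ_one : ∫ ρ in Icc (-1 + γ) (1 - γ), π ρ = 1)
    (ρ₀ : ℝ) (hρ₀ : |ρ₀| < 1 - γ)
    -- the `g`-prior of the regression coefficients
    (b : (s : Finset (Fin p)) → s → ℝ)
    (g : ℕ → ℝ) (hg_pos : ∀ n, 0 < g n) (hg : g =O[atTop] fun _ => (1 : ℝ))
    (hZ : ∀ s : Finset (Fin p), ∀ ρ ∈ Icc (-1 + γ) (1 - γ), ∀ᶠ n in atTop,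
      ((AR1Selection.designZ x s n ρ)ᵀ * AR1Selection.designZ x s n ρ).det ≠ 0)
    -- the inverse-gamma prior of the error variance
    (α β : ℝ) (hα : 2 < α) (hβ : 0 < β)
    -- the true set of covariates, the true error variance and the data
    (s₀ : Finset (Fin p)) (v₀ : ℝ) (hv₀ : 0 < v₀)
    (Y : (n : ℕ) → Ω → EuclideanSpace ℝ (Fin n))
    (hY : ∀ᶠ n in atTop, HasLaw (Y n) (AR1Selection.modelLaw x b g s₀ n ρ₀ v₀) P)
    -- separation of the means
    (hsep : ∀ s : Finset (Fin p), s ≠ s₀ → ∀ ρ ∈ Icc (-1 + γ) (1 - γ),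
      0 < liminf (fun n : ℕ => ((1 / (n : ℝ) *
        ∑ t, (AR1Selection.meanVec x b s n ρ t - AR1Selection.meanVec x b s₀ n ρ₀ t) ^ 2 : ℝ) :
          EReal)) atTop)
    -- semicontinuity of the upper and lower limits of the expected scaled log-Bayes factor
    (husc : ∀ s : Finset (Fin p), s ≠ s₀ → UpperSemicontinuousOn
      (fun ρ => limsup (fun n : ℕ => ((∫ ω, 1 / (n : ℝ) *
        Real.log (AR1Selection.bayesFactor x b g α β s s₀ ρ₀ n ρ (Y n ω)) ∂P : ℝ) : EReal)) atTop)
      (Icc (-1 + γ) (1 - γ)))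
    (hlsc : ∀ s : Finset (Fin p), s ≠ s₀ → LowerSemicontinuousOn
      (fun ρ => liminf (fun n : ℕ => ((∫ ω, 1 / (n : ℝ) *
        Real.log (AR1Selection.bayesFactor x b g α β s s₀ ρ₀ n ρ (Y n ω)) ∂P : ℝ) : EReal)) atTop)
      (Icc (-1 + γ) (1 - γ))) :
    ∃ δ : ℝ, 0 < δ ∧ ∀ᵐ ω ∂P,
      (⨆ s : {s : Finset (Fin p) // s ≠ s₀}, limsup (fun n : ℕ => ((1 / (n : ℝ) *
        Real.log (AR1Selection.integratedBayesFactor x b g α β s s₀ ρ₀ γ π n (Y n ω)) : ℝ) :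
          EReal)) atTop) = ((-δ : ℝ) : EReal) := by
  have hα0 : 0 < α := by linarith
  -- A non-integrable density would have integral zero by convention, not one.
  have hπ : IntegrableOn π (Icc (-1 + γ) (1 - γ)) := by
    by_contra h
    rw [integral_undef h] at hπ_one
    exact zero_ne_one hπ_one
  choose C G hD using fun s =>
    AR1Selection.exists_boundedDesign hK hx hγ hρ₀ b hg_pos hg hZ s s₀ hv₀
  have hreg : ∀ᵐ ω ∂P, ∀ s, AR1Selection.RegularData x b g s s₀ ρ₀ v₀ fun n => Y n ω :=
    ae_all_iff.2 fun s => AR1Selection.ae_regularData (hD s) hY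
  -- A typical reference outcome: `δ` is read off from it, and every other typical outcome has the
  -- same upper limits.
  obtain ⟨ω₀, hω₀⟩ := hreg.exists
  have hunif := fun s : {s : Finset (Fin p) // s ≠ s₀} =>
    AR1Selection.exists_uniform_separation x b s hγ (hD s).C_nonneg (hD s).design_le (hsep s s.2)
  choose η hη hs using hunif
  have key := fun (s : {s : Finset (Fin p) // s ≠ s₀}) (ω : Ω)
      (hω : ∀ s, AR1Selection.RegularData x b g s s₀ ρ₀ v₀ fun n => Y n ω) =>
    AR1Selection.limsup_integratedBayesFactor (hD s) hα0 hβ hπ_nonneg hπ hπ_one (hη s) (hs s)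
      (hω₀ s) (hω s) (hω₀ s₀) (hω s₀)
  -- Over an empty family of candidates the supremum would be `⊥`; a nonempty finite one attains it
  -- at some `s₁`, where it is a negative real.
  have : Nonempty {s : Finset (Fin p) // s ≠ s₀} := by
    have : Nontrivial (Finset (Fin p)) :=
      ⟨∅, {⟨0, by omega⟩}, (Finset.singleton_ne_empty _).symm⟩
    obtain ⟨s, hs⟩ := exists_ne s₀
    exact ⟨⟨s, hs⟩⟩
  obtain ⟨s₁, hs₁⟩ := exists_eq_ciSup_of_finite
    (f := fun s : {s : Finset (Fin p) // s ≠ s₀} => limsup (fun n : ℕ => ((1 / (n : ℝ) *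
      Real.log (AR1Selection.integratedBayesFactor x b g α β s s₀ ρ₀ γ π n (Y n ω₀)) : ℝ) :
        EReal)) atTop)
  obtain ⟨r, hr, hlim⟩ := (key s₁ ω₀ hω₀).2
  refine ⟨-r, by linarith, ?_⟩
  filter_upwards [hreg] with ω hω
  rw [neg_neg, ← hlim]
  refine Eq.trans ?_ hs₁.symm
  exact iSup_congr fun s => ((key s ω hω).1).symm
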